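/- Fix $a \in [0,1)$ and $b \in (0,1]$. For every integer $n \ge 1$ let $J_x, J_y, J_z$ be the generators of an irreducible unitary $n$-dimensional representation of $SU(2)$, that is, self-adjoint operators on an $n$-dimensional complex inner product space that satisfy $$[J_x,J_y] = iJ_z,\qquad [J_y,J_z] = iJ_x,\qquad [J_z,J_x] = iJ_y$$ and have no common invariant subspace other than $0$ and the whole space. Let $j = \frac{n-1}{2}$ be the spin number. For a self-adjoint operator $A$ and a set $I \subset \mathbb{R}$ let $\mathbb{1}_I(A)$ denote the spectral projection, i.e. the orthogonal projection onto the span of the eigenvectors of $A$ with eigenvalue in $I$, and put $$C_{n,a,b} = \left[\mathbb{1}_{\left(a\left(j+\frac12\right),\,\infty\right)}(J_x),\ \mathbb{1}_{\left(0,\,b\left(j+\frac12\right)\right]}(J_z)\right],$$ where $[S,T] = ST - TS$. Then $$\lim_{n\to\infty} \left\Vert C_{n,a,b} \right\Vert_{\mathrm{op}} = \frac12 .$$ -/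

import Mathlib

/-- `Jx`, `Jy`, `Jz` are the generators of an irreducible unitary representation of `SU(2)` on the
complex inner product space `V` (in infinitesimal form): self-adjoint operators
that satisfy `[Jx, Jy] = i Jz`, `[Jy, Jz] = i Jx`, `[Jz, Jx] = i Jy` and whose only common invariant
subspaces are `0` and `V`, where `V ≠ 0`. -/
structure IsIrreducibleSpin {V : Type*} [NormedAddCommGroup V] [InnerProductSpace ℂ V]
    (Jx Jy Jz : V →ₗ[ℂ] V) : Prop where
  nontrivial : Nontrivial V
  symm_x : Jx.IsSymmetric
  symm_y : Jy.IsSymmetric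
  symm_z : Jz.IsSymmetric
  comm_xy : Jx * Jy - Jy * Jx = Complex.I • Jz
  comm_yz : Jy * Jz - Jz * Jy = Complex.I • Jx
  comm_zx : Jz * Jx - Jx * Jz = Complex.I • Jy
  irreducible : ∀ W : Submodule ℂ V,
    (∀ v ∈ W, Jx v ∈ W) → (∀ v ∈ W, Jy v ∈ W) → (∀ v ∈ W, Jz v ∈ W) → W = ⊥ ∨ W = ⊤

/-- The spectral projection `𝟙_I(A)` of a self-adjoint operator `A` on a finite-dimensional complex
inner product space: the orthogonal projection onto the span of all eigenvectors of `A` whose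
eigenvalue lies in `I`. -/
noncomputable def spectralProjection {V : Type*} [NormedAddCommGroup V] [InnerProductSpace ℂ V]
    [FiniteDimensional ℂ V] (A : V →ₗ[ℂ] V) (I : Set ℝ) : V →L[ℂ] V :=
  (⨆ μ ∈ I, Module.End.eigenspace A (μ : ℂ)).starProjection

/-- The spin number `j = (n - 1) / 2` of the `n`-dimensional irreducible representation. -/
noncomputable def spinNumber (n : ℕ) : ℝ := ((n : ℝ) - 1) / 2

/-- The commutator of `𝟙_{(a(j+1/2), ∞)}(Jx)` and `𝟙_{(0, b(j+1/2)]}(Jz)`, where `j` is the spin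
number in dimension `dim V`. -/
noncomputable def spinCommutator {V : Type*} [NormedAddCommGroup V] [InnerProductSpace ℂ V]
    [FiniteDimensional ℂ V] (a b : ℝ) (Jx Jz : V →ₗ[ℂ] V) : V →L[ℂ] V :=
  let j := spinNumber (Module.finrank ℂ V)
  let P := spectralProjection Jx (Set.Ioi (a * (j + 1 / 2)))
  let Q := spectralProjection Jz (Set.Ioc 0 (b * (j + 1 / 2)))
  P * Q - Q * P

/-! The upper bound 1/2 holds for any two orthogonal projections: their commutator is a quarter of
the commutator of two reflections of norm at most 1.

For the lower bound, look at weight vectors near the equator, where the weight of `Jz` stays bounded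
as n grows. There `Jx / (j + 1/2)` is nearly the Jacobi matrix with off-diagonal entries 1/2, that
is, multiplication by cos θ in the Fourier basis. Polynomials in it converge entrywise by the
three-term recursion, and a polynomial sandwich carries this over to the indicator of (a, ∞)
(`tendsto_sum_indicator_Ioi`, `exists_equatorial_vectors`). Meanwhile the projection of `Jz` becomes
the projection onto negative frequencies, since the upper cutoff escapes to infinity.

The block between nonnegative and negative frequencies is then the Hankel matrix sin(sα)/(πs), with
s = k + l + 1 and α = arccos a. Suitable phases and the imaginary part turn it into sin²(sα)/(πs) =
(1 - cos 2sα)/(2πs). The first term is 1/(2π) times the Hilbert matrix, whose norm π is approached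
along 1/√(k+1); the oscillating term stays bounded on these vectors
(`exists_hankel_form_lower_bound`). Their squared norms are harmonic sums, which diverge, so bounded
errors do not affect the quotient. The truncation N is fixed first, and only then does n tend to
infinity. -/

section SpinRepresentation

open Module

/-! ### Commutators of projections, and spectral projections on eigenvectors. -/

section Projections

variable {V : Type*} [NormedAddCommGroup V] [InnerProductSpace ℂ V]

/-- The commutator of two orthogonal projections has norm at most `1 / 2`. -/
theorem norm_commutator_starProjection_le (U W : Submodule ℂ V) [U.HasOrthogonalProjection]
    [W.HasOrthogonalProjection] :
    ‖U.starProjection * W.starProjection - W.starProjection * U.starProjection‖ ≤ 1 / 2 := by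
  have key : ∀ (X : Submodule ℂ V) [X.HasOrthogonalProjection],
      ‖(2 : ℂ) • X.starProjection - 1‖ ≤ 1 := by
    intro X _
    refine ContinuousLinearMap.opNorm_le_bound _ zero_le_one fun x => ?_
    have : ((2 : ℂ) • X.starProjection - 1) x = X.reflection x := by
      simp [Submodule.reflection_apply, two_smul]
    rw [this, LinearIsometryEquiv.norm_map, one_mul]
  -- Passing from projections to reflections halves each factor, and the identity drops out of the
  -- commutator; hence the factor 1/4.
  set S := (2 : ℂ) • U.starProjection - 1 with hS
  set T := (2 : ℂ) • W.starProjection - 1 with hT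
  have h : U.starProjection * W.starProjection - W.starProjection * U.starProjection
      = (1 / 4 : ℂ) • (S * T - T * S) := by
    rw [hS, hT]
    simp only [sub_mul, mul_sub, smul_mul_assoc, mul_smul_comm, one_mul, mul_one]
    module
  have h1 : ‖S * T‖ ≤ 1 := (norm_mul_le _ _).trans
    (mul_le_one₀ (key U) (norm_nonneg _) (key W))
  have h2 : ‖T * S‖ ≤ 1 := (norm_mul_le _ _).trans
    (mul_le_one₀ (key W) (norm_nonneg _) (key U))
  rw [h, norm_smul]
  have := norm_sub_le (S * T) (T * S)
  norm_num
  linarith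

variable [FiniteDimensional ℂ V]

theorem spectralProjection_apply_of_mem {A : V →ₗ[ℂ] V} {I : Set ℝ} {μ : ℝ} (hμ : μ ∈ I) {x : V}
    (hx : A x = (μ : ℂ) • x) : spectralProjection A I x = x := by
  refine Submodule.starProjection_eq_self_iff.mpr ?_
  exact (le_iSup₂_of_le (f := fun (μ : ℝ) (_ : μ ∈ I) => End.eigenspace A (μ : ℂ)) μ hμ le_rfl)
    (End.mem_eigenspace_iff.mpr hx)

theorem spectralProjection_apply_of_notMem {A : V →ₗ[ℂ] V} (hA : A.IsSymmetric) {I : Set ℝ}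
    {μ : ℝ} (hμ : μ ∉ I) {x : V} (hx : A x = (μ : ℂ) • x) : spectralProjection A I x = 0 := by
  refine (Submodule.starProjection_apply_eq_zero_iff _).mpr ?_
  suffices h : (⨆ ν ∈ I, End.eigenspace A (ν : ℂ)) ≤ (ℂ ∙ x)ᗮ by
    intro y hy
    exact Submodule.mem_orthogonal_singleton_iff_inner_left.mp (h hy)
  refine iSup₂_le fun ν hν y hy => ?_
  rw [Submodule.mem_orthogonal_singleton_iff_inner_right]
  have hne : (μ : ℂ) ≠ (ν : ℂ) := fun h => hμ (by rwa [Complex.ofReal_inj.mp h])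
  exact hA.orthogonalFamily_eigenspaces hne ⟨x, End.mem_eigenspace_iff.mpr hx⟩ ⟨y, hy⟩

end Projections

/-! ### The weight basis of an irreducible representation. -/

namespace IsIrreducibleSpin

variable {V : Type*} [NormedAddCommGroup V] [InnerProductSpace ℂ V] {Jx Jy Jz : V →ₗ[ℂ] V}

/-- Results about the spectrum of `Jz` thereby apply to `Jx`. -/
theorem cyclic (h : IsIrreducibleSpin Jx Jy Jz) : IsIrreducibleSpin Jy Jz Jx :=
  ⟨h.nontrivial, h.symm_y, h.symm_z, h.symm_x, h.comm_yz, h.comm_zx, h.comm_xy,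
    fun W h1 h2 h3 => h.irreducible W h3 h1 h2⟩

/-- A vector of highest weight. -/
theorem exists_highest_weight [FiniteDimensional ℂ V] (h : IsIrreducibleSpin Jx Jy Jz) :
    ∃ (m : ℝ) (v : V), v ≠ 0 ∧ Jz v = (m : ℂ) • v ∧ (Jx + Complex.I • Jy) v = 0 := by
  have := h.nontrivial
  have hfin : Set.Finite {μ : ℂ | End.HasEigenvalue Jz μ} := End.finite_hasEigenvalue Jz
  obtain ⟨μ₀, hμ₀⟩ := End.exists_eigenvalue Jz
  -- The raising operator shifts an eigenvalue by 1, so it must annihilate an eigenvector whose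
  -- eigenvalue has maximal real part.
  obtain ⟨μ, hμ, hmax⟩ := Set.exists_max_image _ Complex.re hfin ⟨μ₀, hμ₀⟩
  obtain ⟨v, hv⟩ := End.HasEigenvalue.exists_hasEigenvector hμ
  have hreal : ((μ.re : ℝ) : ℂ) = μ := by
    have := h.symm_z.conj_eigenvalue_eq_self hμ
    exact Complex.conj_eq_iff_re.mp this
  refine ⟨μ.re, v, hv.2, by rw [hreal]; exact hv.apply_eq_smul, ?_⟩
  by_contra hne
  have hz : Jz ((Jx + Complex.I • Jy) v) = (μ + 1) • (Jx + Complex.I • Jy) v := by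
    have e1 := LinearMap.congr_fun h.comm_zx v
    have e2 := LinearMap.congr_fun h.comm_yz v
    simp only [LinearMap.sub_apply, Module.End.mul_apply, LinearMap.smul_apply,
      hv.apply_eq_smul, map_smul] at e1 e2
    simp only [LinearMap.add_apply, LinearMap.smul_apply, map_add, map_smul]
    rw [sub_eq_iff_eq_add.mp e1, ← sub_eq_iff_eq_add'.mpr (sub_eq_iff_eq_add.mp e2)]
    simp only [smul_add, smul_sub, smul_smul, add_smul, one_smul, Complex.I_mul_I]
    module
  have := hmax (μ + 1) (End.hasEigenvalue_of_hasEigenvector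
    ⟨End.mem_eigenspace_iff.mpr hz, hne⟩)
  simp at this
  linarith

/-- The weight vectors obtained from a highest weight vector by applying the lowering operator. -/
theorem exists_lowering_sequence [FiniteDimensional ℂ V] (h : IsIrreducibleSpin Jx Jy Jz) :
    ∃ u : ℕ → V,
      (∀ i, Jz (u i) = ((((finrank ℂ V : ℝ) - 1) / 2 - i : ℝ) : ℂ) • u i) ∧
      (∀ i, (Jx - Complex.I • Jy) (u i) = u (i + 1)) ∧
      (∀ i, (Jx + Complex.I • Jy) (u (i + 1)) =
        ((((i : ℝ) + 1) * ((finrank ℂ V : ℝ) - 1 - i) : ℝ) : ℂ) • u i) ∧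
      (∀ i, ‖u (i + 1)‖ ^ 2 = ((i : ℝ) + 1) * ((finrank ℂ V : ℝ) - 1 - i) * ‖u i‖ ^ 2) ∧
      (∀ i k, i ≠ k → inner ℂ (u i) (u k) = 0) ∧
      (∀ i, u i = 0 ↔ finrank ℂ V ≤ i) := by
  obtain ⟨m, v, hv0, hvz, hvE⟩ := h.exists_highest_weight
  set E := Jx + Complex.I • Jy with hE
  set F := Jx - Complex.I • Jy with hF
  have hEF : ∀ x, E (F x) = F (E x) + (2 : ℂ) • Jz x := by
    intro x
    have e := LinearMap.congr_fun h.comm_xy x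
    simp only [LinearMap.sub_apply, Module.End.mul_apply, LinearMap.smul_apply] at e
    simp only [hE, hF, LinearMap.add_apply, LinearMap.sub_apply, LinearMap.smul_apply, map_add,
      map_sub, map_smul]
    have e' : Jz x = -(Complex.I • (Jx (Jy x) - Jy (Jx x))) := by
      rw [e, smul_smul, Complex.I_mul_I, neg_one_smul, neg_neg]
    rw [e']
    module
  have hzF : ∀ x, Jz (F x) = F (Jz x) - F x := by
    intro x
    have e1 := LinearMap.congr_fun h.comm_zx x
    have e2 := LinearMap.congr_fun h.comm_yz x
    simp only [LinearMap.sub_apply, Module.End.mul_apply, LinearMap.smul_apply] at e1 e2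
    simp only [hF, LinearMap.sub_apply, LinearMap.smul_apply, map_sub, map_smul]
    rw [sub_eq_iff_eq_add.mp e1, ← sub_eq_iff_eq_add'.mpr (sub_eq_iff_eq_add.mp e2)]
    simp only [smul_sub, smul_smul, Complex.I_mul_I]
    module
  have hadj : ∀ x y, inner ℂ (F x) y = inner ℂ x (E y) := by
    intro x y
    simp only [hE, hF, LinearMap.add_apply, LinearMap.sub_apply, LinearMap.smul_apply,
      inner_add_right, inner_sub_left, inner_smul_left, inner_smul_right, h.symm_x x y,
      h.symm_y x y, Complex.conj_I]
    ring
  let u : ℕ → V := fun i => (F ^ i) v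
  have hu0 : u 0 = v := by simp [u]
  have huF : ∀ i, F (u i) = u (i + 1) := fun i => by
    simp only [u, pow_succ', Module.End.mul_apply]
  have huz : ∀ i, Jz (u i) = ((m - i : ℝ) : ℂ) • u i := by
    intro i
    induction i with
    | zero => simp [hu0, hvz]
    | succ i ih =>
      rw [← huF, hzF, ih, map_smul]
      push_cast
      module
  have huE : ∀ i, E (u (i + 1)) = ((((i : ℝ) + 1) * (2 * m - i) : ℝ) : ℂ) • u i := by
    intro i
    induction i with
    | zero =>
      rw [← huF, hEF, hu0, hvE, hvz, map_zero]
      push_cast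
      module
    | succ i ih =>
      rw [← huF (i + 1), hEF, ih, huz, map_smul, huF]
      push_cast
      module
  have hun : ∀ i, ‖u (i + 1)‖ ^ 2 = ((i : ℝ) + 1) * (2 * m - i) * ‖u i‖ ^ 2 := by
    intro i
    have e : inner ℂ (u (i + 1)) (u (i + 1)) =
        ((((i : ℝ) + 1) * (2 * m - i) : ℝ) : ℂ) * inner ℂ (u i) (u i) := by
      conv_lhs => rw [← huF i, hadj, huF i, huE, inner_smul_right]
    rw [inner_self_eq_norm_sq_to_K, inner_self_eq_norm_sq_to_K] at e
    refine Complex.ofReal_injective ?_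
    push_cast at e ⊢
    exact e
  have horth : ∀ i k, i ≠ k → inner ℂ (u i) (u k) = 0 := by
    intro i k hik
    have hne : ((m - i : ℝ) : ℂ) ≠ ((m - k : ℝ) : ℂ) := by
      intro e
      have e' := Complex.ofReal_inj.mp e
      exact hik (by exact_mod_cast (sub_right_inj.mp e'))
    exact h.symm_z.orthogonalFamily_eigenspaces hne ⟨u i, End.mem_eigenspace_iff.mpr (huz i)⟩
      ⟨u k, End.mem_eigenspace_iff.mpr (huz k)⟩
  -- The ladder terminates: for i > 2m a nonzero `u i` would give `u (i + 1)` a negative squared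
  -- norm.
  have hex : ∃ N, u N = 0 := by
    obtain ⟨i, hi⟩ := exists_nat_gt (2 * m)
    refine ⟨i, ?_⟩
    by_contra hne
    have h1 := hun i
    have h2 : 0 < ‖u i‖ ^ 2 := by positivity
    have h3 : ((i : ℝ) + 1) * (2 * m - i) < 0 :=
      mul_neg_of_pos_of_neg (by positivity) (by linarith)
    nlinarith [sq_nonneg ‖u (i + 1)‖]
  classical
  obtain ⟨k, hk⟩ : ∃ k, Nat.find hex = k + 1 := Nat.exists_eq_succ_of_ne_zero fun h0 => by
    have := Nat.find_spec hex
    rw [h0, hu0] at this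
    exact hv0 this
  have hzero : ∀ i, k + 1 ≤ i → u i = 0 := by
    intro i hi
    induction i, hi using Nat.le_induction with
    | base => rw [← hk]; exact Nat.find_spec hex
    | succ i _ ih => rw [← huF, ih, map_zero]
  have hnonzero : ∀ i, i < k + 1 → u i ≠ 0 := fun i hi => Nat.find_min hex (by rwa [hk])
  -- `u k` is the last nonzero vector, so the norm recursion at k has a vanishing factor, which can
  -- only be 2m - k.
  have hm : 2 * m = k := by
    have h1 := hun k
    rw [hzero _ le_rfl, norm_zero] at h1
    have h2 : ‖u k‖ ^ 2 ≠ 0 := by simpa using hnonzero k (Nat.lt_succ_self k)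
    have h3 : ((k : ℝ) + 1) ≠ 0 := by positivity
    have h4 : 2 * m - k = 0 := by
      by_contra hne
      exact mul_ne_zero (mul_ne_zero h3 hne) h2 (by rw [← h1]; ring)
    linarith
  -- The span of the ladder is invariant under both ladder operators and `Jz`, so irreducibility
  -- applies; this identifies the dimension as k + 1.
  have hspan : Submodule.span ℂ (Set.range fun i : Fin (k + 1) => u i) = ⊤ := by
    set W := Submodule.span ℂ (Set.range fun i : Fin (k + 1) => u i) with hW
    have hmem : ∀ i, u i ∈ W := by
      intro i
      by_cases hi : i < k + 1
      · exact Submodule.subset_span ⟨⟨i, hi⟩, rfl⟩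
      · rw [hzero i (not_lt.mp hi)]
        exact W.zero_mem
    have hinv : ∀ T : V →ₗ[ℂ] V, (∀ i, T (u i) ∈ W) → ∀ x ∈ W, T x ∈ W := by
      intro T hT x hx
      have : W ≤ W.comap T := Submodule.span_le.mpr (by rintro _ ⟨i, rfl⟩; exact hT i)
      exact this hx
    have hWF : ∀ x ∈ W, F x ∈ W := hinv F fun i => by rw [huF]; exact hmem _
    have hWE : ∀ x ∈ W, E x ∈ W := hinv E fun i => by
      cases i with
      | zero => rw [hu0, hvE]; exact W.zero_mem
      | succ i => rw [huE]; exact W.smul_mem _ (hmem _)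
    have hWz : ∀ x ∈ W, Jz x ∈ W := hinv Jz fun i => by rw [huz]; exact W.smul_mem _ (hmem _)
    refine (h.irreducible W (fun x hx => ?_) (fun x hx => ?_) hWz).resolve_left fun hbot => ?_
    · have : Jx x = (1 / 2 : ℂ) • (E x + F x) := by
        simp only [hE, hF, LinearMap.add_apply, LinearMap.sub_apply, LinearMap.smul_apply]
        module
      rw [this]
      exact W.smul_mem _ (W.add_mem (hWE x hx) (hWF x hx))
    · have : Jy x = (-Complex.I / 2 : ℂ) • (E x - F x) := by
        have e : (-Complex.I / 2 : ℂ) • (E x - F x) = (-(Complex.I * Complex.I)) • Jy x := by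
          simp only [hE, hF, LinearMap.add_apply, LinearMap.sub_apply, LinearMap.smul_apply]
          module
        rw [e, Complex.I_mul_I, neg_neg, one_smul]
      rw [this]
      exact W.smul_mem _ (W.sub_mem (hWE x hx) (hWF x hx))
    · have := hmem 0
      rw [hbot, Submodule.mem_bot, hu0] at this
      exact hv0 this
  have hli : LinearIndependent ℂ fun i : Fin (k + 1) => u i :=
    linearIndependent_of_ne_zero_of_inner_eq_zero (fun i => hnonzero i i.2)
      fun i l hil => horth _ _ fun e => hil (Fin.ext e)
  have hn : finrank ℂ V = k + 1 := by
    have := finrank_span_eq_card hli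
    rwa [hspan, finrank_top, Fintype.card_fin] at this
  have hmn : ((finrank ℂ V : ℝ) - 1) = 2 * m := by rw [hn, hm]; push_cast; ring
  refine ⟨u, ?_, huF, ?_, ?_, horth, fun i => ?_⟩
  · rw [hmn, mul_div_cancel_left₀ m two_ne_zero]; exact huz
  · rw [hmn]; exact huE
  · rw [hmn]; exact hun
  · rw [hn]
    exact ⟨fun e => not_lt.mp fun hi => hnonzero i hi e, hzero i⟩

/-- In a suitable orthonormal family of weight vectors `Jz` is diagonal and `Jx` is a Jacobi
matrix. -/
theorem exists_weight_vectors [FiniteDimensional ℂ V] (h : IsIrreducibleSpin Jx Jy Jz) :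
    ∃ v : ℕ → V,
      (∀ i k, i < finrank ℂ V → k < finrank ℂ V → inner ℂ (v i) (v k) = if i = k then 1 else 0) ∧
      (∀ i, Jz (v i) = ((((finrank ℂ V : ℝ) - 1) / 2 - i : ℝ) : ℂ) • v i) ∧
      (∀ i, Jx (v (i + 1)) =
        ((√(((i : ℝ) + 1) * ((finrank ℂ V : ℝ) - 1 - i)) / 2 : ℝ) : ℂ) • v i +
        ((√(((i : ℝ) + 2) * ((finrank ℂ V : ℝ) - 2 - i)) / 2 : ℝ) : ℂ) • v (i + 2)) := by
  obtain ⟨u, huz, huF, huE, hun, horth, hzero⟩ := h.exists_lowering_sequence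
  have hnorm : ∀ i, i < finrank ℂ V →
      ‖u (i + 1)‖ = √(((i : ℝ) + 1) * ((finrank ℂ V : ℝ) - 1 - i)) * ‖u i‖ := by
    intro i hi
    have h0 : 0 ≤ ((i : ℝ) + 1) * ((finrank ℂ V : ℝ) - 1 - i) := by
      have : ((i : ℝ) + 1) ≤ finrank ℂ V := by exact_mod_cast hi
      exact mul_nonneg (by positivity) (by linarith)
    rw [← Real.sqrt_sq (norm_nonneg (u (i + 1))), hun, Real.sqrt_mul h0,
      Real.sqrt_sq (norm_nonneg _)]
  have hpos : ∀ i, i < finrank ℂ V → 0 < ‖u i‖ := fun i hi =>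
    norm_pos_iff.mpr fun e => not_le.mpr hi ((hzero i).mp e)
  -- From index `finrank ℂ V` on these vectors are 0, so the Jacobi relation needs no upper bound on
  -- i.
  refine ⟨fun i => ((‖u i‖⁻¹ : ℝ) : ℂ) • u i, fun i k hi hk => ?_, fun i => ?_, fun i => ?_⟩
  · rw [inner_smul_left, inner_smul_right]
    split_ifs with hik
    · subst hik
      rw [inner_self_eq_norm_sq_to_K]
      have := (hpos i hi).ne'
      simp only [Complex.conj_ofReal, Complex.coe_algebraMap]
      norm_cast
      field_simp
    · rw [horth i k hik, mul_zero, mul_zero]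
  · rw [map_smul, huz, smul_comm]
  · have hx : Jx (u (i + 1)) = (1 / 2 : ℂ) • ((Jx + Complex.I • Jy) (u (i + 1)) +
        (Jx - Complex.I • Jy) (u (i + 1))) := by
      simp only [LinearMap.add_apply, LinearMap.sub_apply, LinearMap.smul_apply]
      module
    rw [map_smul, hx, huE, huF]
    by_cases hi : i + 1 < finrank ℂ V
    · have n1 := hnorm i (by omega)
      have n2 := hnorm (i + 1) hi
      have p0 := hpos i (by omega)
      have p1 := hpos (i + 1) hi
      set d := √(((i : ℝ) + 1) * ((finrank ℂ V : ℝ) - 1 - i)) with hd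
      have hdd : ((i : ℝ) + 1) * ((finrank ℂ V : ℝ) - 1 - i) = d * d := by
        rw [hd, Real.mul_self_sqrt]
        have : ((i : ℝ) + 1) ≤ finrank ℂ V := by exact_mod_cast (by omega : i + 1 ≤ _)
        exact mul_nonneg (by positivity) (by linarith)
      have hd2 : √(((i : ℝ) + 2) * ((finrank ℂ V : ℝ) - 2 - i)) * ‖u (i + 1)‖ = ‖u (i + 2)‖ := by
        rw [n2]
        push_cast
        congr 3 <;> ring
      have hc1 : ‖u (i + 1)‖⁻¹ * (1 / 2 * (d * d)) = d / 2 * ‖u i‖⁻¹ := by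
        rw [n1] at p1 ⊢
        have : d ≠ 0 := fun e => by simp [e] at p1
        field_simp
      have hc2 : u (i + 2) = 0 ∨ ‖u (i + 1)‖⁻¹ * (1 / 2) =
          √(((i : ℝ) + 2) * ((finrank ℂ V : ℝ) - 2 - i)) / 2 * ‖u (i + 2)‖⁻¹ := by
        refine or_iff_not_imp_left.mpr fun hne => ?_
        have p2 : 0 < ‖u (i + 2)‖ := norm_pos_iff.mpr hne
        rw [← hd2] at p2 ⊢
        have : √(((i : ℝ) + 2) * ((finrank ℂ V : ℝ) - 2 - i)) ≠ 0 := fun e => by simp [e] at p2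
        field_simp
      rw [hdd, smul_add, smul_add, smul_smul, smul_smul, smul_smul, smul_smul]
      congr 1
      · rw [← Complex.ofReal_mul, ← hc1]; push_cast; ring_nf
      · rw [show i + 1 + 1 = i + 2 from rfl, smul_smul]
        rcases hc2 with e | e
        · rw [e, smul_zero, smul_zero]
        · rw [← Complex.ofReal_mul, ← e]; push_cast; ring_nf
    · have z1 : u (i + 1) = 0 := (hzero _).mpr (by omega)
      have z2 : u (i + 2) = 0 := (hzero _).mpr (by omega)
      rw [show i + 1 + 1 = i + 2 from rfl, z1, z2, norm_zero, inv_zero]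
      -- At the end of the ladder the square root vanishes; past it `u i` does.
      by_cases hi' : i < finrank ℂ V
      · have e : (finrank ℂ V : ℝ) - 1 - i = 0 := by
          have : finrank ℂ V = i + 1 := by omega
          rw [this]; push_cast; ring
        simp [e, z2]
      · simp [z2, (hzero i).mpr (by omega)]

end IsIrreducibleSpin

end SpinRepresentation

/-! ### Asymptotics of the Hankel form on the vectors 1/√(k+1). -/

section HankelForm

open Finset Real

/-- Abel summation bound. -/
theorem abs_sum_mul_le_of_antitone {a b : ℕ → ℝ} (ha : Antitone a) (ha0 : ∀ n, 0 ≤ a n) {B : ℝ}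
    (hB : ∀ m, |∑ l ∈ range m, b l| ≤ B) (N : ℕ) : |∑ l ∈ range N, a l * b l| ≤ B * a 0 := by
  have key : |∑ l ∈ range N, a l * b l - a N * ∑ l ∈ range N, b l| ≤ B * (a 0 - a N) := by
    induction N with
    | zero => simp
    | succ N ih =>
      have e : ∑ l ∈ range (N + 1), a l * b l - a (N + 1) * ∑ l ∈ range (N + 1), b l =
          (∑ l ∈ range N, a l * b l - a N * ∑ l ∈ range N, b l) +
          (a N - a (N + 1)) * ∑ l ∈ range (N + 1), b l := by
        rw [sum_range_succ, sum_range_succ]; ring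
      have h0 : 0 ≤ a N - a (N + 1) := sub_nonneg.mpr (ha N.le_succ)
      rw [e]
      refine (abs_add_le _ _).trans ?_
      rw [abs_mul, abs_of_nonneg h0]
      have := mul_le_mul_of_nonneg_left (hB (N + 1)) h0
      linarith
  have h2 : |a N * ∑ l ∈ range N, b l| ≤ B * a N := by
    rw [abs_mul, abs_of_nonneg (ha0 N), mul_comm B]
    exact mul_le_mul_of_nonneg_left (hB N) (ha0 N)
  have := abs_add_le (∑ l ∈ range N, a l * b l - a N * ∑ l ∈ range N, b l)
    (a N * ∑ l ∈ range N, b l)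
  rw [sub_add_cancel] at this
  linarith

/-- Multiplication by 2 sin α makes the sum telescope. Uniformity in m and φ is what Abel summation
needs. -/
theorem abs_sum_cos_le {α : ℝ} (hα : 0 < sin α) (φ : ℝ) (m : ℕ) :
    |∑ l ∈ range m, cos (2 * α * l + φ)| ≤ 1 / sin α := by
  have key : 2 * sin α * ∑ l ∈ range m, cos (2 * α * l + φ) =
      sin (2 * α * m + φ - α) - sin (φ - α) := by
    induction m with
    | zero => simp
    | succ m ih =>
      rw [sum_range_succ, mul_add, ih]
      have e1 : 2 * α * ((m + 1 : ℕ) : ℝ) + φ - α = (2 * α * m + φ) + α := by push_cast; ring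
      rw [e1, sin_add, sin_sub (2 * α * m + φ) α]
      ring
  have h : |2 * sin α * ∑ l ∈ range m, cos (2 * α * l + φ)| ≤ 2 := by
    rw [key]
    have h1 := abs_sin_le_one (2 * α * m + φ - α)
    have h2 := abs_sin_le_one (φ - α)
    have := abs_sub (sin (2 * α * m + φ - α)) (sin (φ - α))
    linarith
  rw [abs_mul, abs_of_pos (by positivity : 0 < 2 * sin α)] at h
  rw [le_div_iff₀ hα]
  linarith

theorem exists_sum_inv_mul_sqrt_le :
    ∃ Z : ℝ, 0 ≤ Z ∧ ∀ N, ∑ k ∈ range N, 1 / (((k : ℝ) + 1) * √((k : ℝ) + 1)) ≤ Z := by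
  have hs : Summable fun k : ℕ => 1 / (((k : ℝ) + 1) * √((k : ℝ) + 1)) := by
    have h := (summable_nat_add_iff 1).mpr
      (Real.summable_one_div_nat_rpow.mpr (by norm_num : (1 : ℝ) < 3 / 2))
    refine h.congr fun k => ?_
    have hk : (0 : ℝ) < (k : ℝ) + 1 := by positivity
    rw [show (3 / 2 : ℝ) = 1 + 1 / 2 by norm_num]
    push_cast
    rw [rpow_add hk, rpow_one, ← sqrt_eq_rpow]
  exact ⟨_, tsum_nonneg fun k => by positivity, fun N => hs.sum_le_tsum _ fun k _ => by positivity⟩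

theorem sum_inv_sqrt_le (N : ℕ) : ∑ k ∈ range N, 1 / √((k : ℝ) + 1) ≤ 2 * √N := by
  induction N with
  | zero => simp
  | succ N ih =>
    rw [sum_range_succ]
    push_cast
    have h1 : 0 < √((N : ℝ) + 1) := sqrt_pos.mpr (by positivity)
    have h2 : √(N : ℝ) ≤ √((N : ℝ) + 1) := sqrt_le_sqrt (by linarith)
    have h3 : √((N : ℝ) + 1) ^ 2 = N + 1 := sq_sqrt (by positivity)
    have h4 : √(N : ℝ) ^ 2 = N := sq_sqrt (by positivity)
    have : 1 / √((N : ℝ) + 1) ≤ 2 * √((N : ℝ) + 1) - 2 * √N := by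
      rw [div_le_iff₀ h1]
      nlinarith [sqrt_nonneg (N : ℝ), sq_nonneg (√((N : ℝ) + 1) - √(N : ℝ))]
    linarith

theorem arctan_le_self {x : ℝ} (hx : 0 ≤ x) : arctan x ≤ x := by
  have h0 : 0 ≤ arctan x := arctan_nonneg.mpr hx
  have := le_tan h0 (arctan_lt_pi_div_two x)
  rwa [tan_arctan] at this

/-- The arctangent expression is an antiderivative of the decreasing function 1/(√s (s + K)); by the
mean value theorem its increment over a unit interval is at most the value at the left end. -/
theorem arctan_sqrt_step {K t : ℝ} (hK : 0 < K) (ht : 0 < t) :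
    2 / √K * arctan (√(t + 1) / √K) - 2 / √K * arctan (√t / √K) ≤ 1 / (√t * (t + K)) := by
  have hd : ∀ s ∈ Set.Icc t (t + 1), HasDerivAt (fun s => 2 / √K * arctan (√s / √K))
      (1 / (√s * (s + K))) s := by
    intro s hs
    have hs0 : 0 < s := ht.trans_le hs.1
    have h1 := (((hasDerivAt_sqrt hs0.ne').div_const √K).arctan).const_mul (2 / √K)
    refine h1.congr_deriv ?_
    have a1 : 0 < √s := sqrt_pos.mpr hs0
    have a2 : 0 < √K := sqrt_pos.mpr hK
    have a3 : √s ^ 2 = s := sq_sqrt hs0.le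
    have a4 : √K ^ 2 = K := sq_sqrt hK.le
    rw [div_pow, a3, a4]
    have e : 2 / √K * (1 / (1 + s / K) * (1 / (2 * √s) / √K)) =
        1 / (√s * (√K ^ 2 * (1 + s / K))) := by
      have : 0 < 1 + s / K := by positivity
      field_simp
    rw [e, a4]
    congr 2
    field_simp
    ring
  obtain ⟨c, hc, hc'⟩ := exists_hasDerivAt_eq_slope _ _ (by linarith : t < t + 1)
    (fun s hs => (hd s hs).continuousAt.continuousWithinAt)
    (fun s hs => hd s (Set.Ioo_subset_Icc_self hs))
  rw [add_sub_cancel_left, div_one] at hc'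
  rw [← hc']
  have h1 : √t ≤ √c := sqrt_le_sqrt hc.1.le
  have h2 : 0 < √t := sqrt_pos.mpr ht
  have := hc.1
  gcongr

/-- With K = k + 1, row k is compared with the integral of 1/(√s (s + K)), which is π/√K over (0,
∞); the weight 1/√K makes this π/K. Cutting at s = N + 1 costs 2/√((N+1)K), with total at most 4,
and starting at s = 1 costs 2/K^(3/2), which is summable. -/
theorem exists_hilbert_form_lower_bound :
    ∃ C : ℝ, ∀ N : ℕ, π * ∑ k ∈ range N, 1 / ((k : ℝ) + 1) - C ≤
      ∑ k ∈ range N, ∑ l ∈ range N,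
        1 / √((k : ℝ) + 1) * (1 / √((l : ℝ) + 1)) * (1 / ((k : ℝ) + l + 1)) := by
  obtain ⟨Z, hZ0, hZ⟩ := exists_sum_inv_mul_sqrt_le
  refine ⟨4 + 2 * Z, fun N => ?_⟩
  set M : ℝ := N + 1 with hM
  have hM0 : 0 < M := by positivity
  have row : ∀ k ∈ range N, π * (1 / ((k : ℝ) + 1)) - 2 / √M * (1 / √((k : ℝ) + 1)) -
      2 * (1 / (((k : ℝ) + 1) * √((k : ℝ) + 1))) ≤ ∑ l ∈ range N,
        1 / √((k : ℝ) + 1) * (1 / √((l : ℝ) + 1)) * (1 / ((k : ℝ) + l + 1)) := by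
    intro k _
    set K : ℝ := k + 1 with hK
    have hK0 : 0 < K := by positivity
    have sK : 0 < √K := sqrt_pos.mpr hK0
    have sM : 0 < √M := sqrt_pos.mpr hM0
    have hKK : √K * √K = K := mul_self_sqrt hK0.le
    have tel : 2 / √K * arctan (√M / √K) - 2 / √K * arctan (1 / √K) ≤
        ∑ l ∈ range N, 1 / √((l : ℝ) + 1) * (1 / ((k : ℝ) + l + 1)) := by
      have := sum_range_sub (fun l : ℕ => 2 / √K * arctan (√((l : ℝ) + 1) / √K)) N
      simp only [Nat.cast_zero, zero_add, sqrt_one] at this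
      rw [← hM] at this
      rw [← this]
      refine sum_le_sum fun l _ => ?_
      have hl : (0 : ℝ) < (l : ℝ) + 1 := by positivity
      have step := arctan_sqrt_step hK0 hl
      push_cast
      refine step.trans ?_
      rw [one_div_mul_one_div]
      have : 0 < √((l : ℝ) + 1) := sqrt_pos.mpr hl
      -- The integrand at s = l + 1 has k + l + 2 where the form has k + l + 1; the discrepancy has
      -- the favourable sign.
      have : (k : ℝ) + l + 1 ≤ (l : ℝ) + 1 + K := by rw [hK]; linarith
      gcongr
    have at1 : π / 2 - √K / √M ≤ arctan (√M / √K) := by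
      have h1 := arctan_inv_of_pos (div_pos sK sM)
      rw [inv_div] at h1
      rw [h1]
      linarith [arctan_le_self (div_pos sK sM).le]
    have at2 : arctan (1 / √K) ≤ 1 / √K := arctan_le_self (by positivity)
    simp_rw [mul_assoc]
    rw [← mul_sum]
    refine le_trans ?_ (mul_le_mul_of_nonneg_left tel (by positivity))
    have h3 : 2 / √K * (π / 2 - √K / √M - 1 / √K) ≤
        2 / √K * arctan (√M / √K) - 2 / √K * arctan (1 / √K) := by
      rw [← mul_sub]
      exact mul_le_mul_of_nonneg_left (by linarith) (by positivity)
    refine le_trans (le_of_eq ?_) (mul_le_mul_of_nonneg_left h3 (by positivity))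
    rw [← hKK]
    rw [sqrt_mul_self sK.le]
    field_simp
  refine le_trans ?_ (sum_le_sum row)
  rw [sum_sub_distrib, sum_sub_distrib, ← mul_sum, ← mul_sum, ← mul_sum]
  have h1 := hZ N
  have h2 : 2 / √M * ∑ k ∈ range N, 1 / √((k : ℝ) + 1) ≤ 4 := by
    have sM : 0 < √M := sqrt_pos.mpr hM0
    have : √(N : ℝ) ≤ √M := sqrt_le_sqrt (by rw [hM]; linarith)
    have := mul_le_mul_of_nonneg_left (sum_inv_sqrt_le N) (by positivity : 0 ≤ 2 / √M)
    refine this.trans ?_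
    rw [div_mul_eq_mul_div, div_le_iff₀ sM]
    linarith
  linarith

/-- In row k the weights decrease in l from the initial value 1/(k+1), so Abel summation against the
cosines bounds the row by (k+1)^(-3/2)/sin α, which is summable. -/
theorem exists_oscillating_form_bound {α : ℝ} (hα : 0 < sin α) :
    ∃ C : ℝ, ∀ N : ℕ, |∑ k ∈ range N, ∑ l ∈ range N,
        1 / √((k : ℝ) + 1) * (1 / √((l : ℝ) + 1)) *
          (cos (2 * (((k : ℝ) + l + 1) * α)) / ((k : ℝ) + l + 1))| ≤ C := by
  obtain ⟨Z, hZ0, hZ⟩ := exists_sum_inv_mul_sqrt_le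
  refine ⟨1 / sin α * Z, fun N => ?_⟩
  refine (abs_sum_le_sum_abs _ _).trans ?_
  refine le_trans ?_ (mul_le_mul_of_nonneg_left (hZ N) (by positivity))
  rw [mul_sum]
  refine sum_le_sum fun k _ => ?_
  have hk : (0 : ℝ) < (k : ℝ) + 1 := by positivity
  have sk : 0 < √((k : ℝ) + 1) := sqrt_pos.mpr hk
  have key := abs_sum_mul_le_of_antitone
    (a := fun l : ℕ => 1 / √((l : ℝ) + 1) * (1 / ((k : ℝ) + l + 1)))
    (b := fun l : ℕ => cos (2 * α * l + 2 * α * (k + 1)))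
    (fun l l' hl => by
      have hl' : (l : ℝ) ≤ l' := by exact_mod_cast hl
      have : 0 < √((l : ℝ) + 1) := sqrt_pos.mpr (by positivity)
      dsimp only
      gcongr) (fun l => by positivity)
    (fun m => abs_sum_cos_le hα _ m) N
  have e : ∑ l ∈ range N, 1 / √((k : ℝ) + 1) * (1 / √((l : ℝ) + 1)) *
      (cos (2 * (((k : ℝ) + l + 1) * α)) / ((k : ℝ) + l + 1)) =
      1 / √((k : ℝ) + 1) * ∑ l ∈ range N, 1 / √((l : ℝ) + 1) * (1 / ((k : ℝ) + l + 1)) *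
        cos (2 * α * l + 2 * α * (k + 1)) := by
    rw [mul_sum]
    refine sum_congr rfl fun l _ => ?_
    rw [show 2 * (((k : ℝ) + l + 1) * α) = 2 * α * l + 2 * α * (k + 1) by ring]
    ring
  rw [e, abs_mul, abs_of_pos (by positivity : 0 < 1 / √((k : ℝ) + 1))]
  refine (mul_le_mul_of_nonneg_left key (by positivity)).trans (le_of_eq ?_)
  simp only [Nat.cast_zero, zero_add, sqrt_one, add_zero]
  field_simp

/-- Along the vectors `1 / √(k + 1)`, the Hankel form with entries `sin² (s α) / (π s)`,
`s = k + l + 1`, attains the value `1 / 2` asymptotically. -/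
theorem exists_hankel_form_lower_bound {α : ℝ} (hα : 0 < sin α) :
    ∃ C : ℝ, ∀ N : ℕ, 1 / 2 * ∑ k ∈ range N, 1 / ((k : ℝ) + 1) - C ≤
      ∑ k ∈ range N, ∑ l ∈ range N, 1 / √((k : ℝ) + 1) * (1 / √((l : ℝ) + 1)) *
          (sin (((k : ℝ) + l + 1) * α) ^ 2 / (π * ((k : ℝ) + l + 1))) := by
  obtain ⟨C₁, h₁⟩ := exists_hilbert_form_lower_bound
  obtain ⟨C₂, h₂⟩ := exists_oscillating_form_bound hα
  refine ⟨(C₁ + C₂) / (2 * π), fun N => ?_⟩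
  have e : ∑ k ∈ range N, ∑ l ∈ range N, 1 / √((k : ℝ) + 1) * (1 / √((l : ℝ) + 1)) *
          (sin (((k : ℝ) + l + 1) * α) ^ 2 / (π * ((k : ℝ) + l + 1))) =
      1 / (2 * π) * (∑ k ∈ range N, ∑ l ∈ range N,
        1 / √((k : ℝ) + 1) * (1 / √((l : ℝ) + 1)) * (1 / ((k : ℝ) + l + 1)) -
      ∑ k ∈ range N, ∑ l ∈ range N,
        1 / √((k : ℝ) + 1) * (1 / √((l : ℝ) + 1)) *
          (cos (2 * (((k : ℝ) + l + 1) * α)) / ((k : ℝ) + l + 1))) := by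
    rw [← sum_sub_distrib, mul_sum]
    refine sum_congr rfl fun k _ => ?_
    rw [← sum_sub_distrib, mul_sum]
    refine sum_congr rfl fun l _ => ?_
    have hs : (0 : ℝ) < (k : ℝ) + l + 1 := by positivity
    rw [cos_two_mul, cos_sq']
    field_simp
    ring
  rw [e]
  have h3 := h₁ N
  have h4 := (abs_le.mp (h₂ N)).2
  have h5 : 0 < 1 / (2 * π) := by positivity
  have h6 := mul_le_mul_of_nonneg_left (sub_le_sub h3 h4) h5.le
  refine le_trans (le_of_eq ?_) h6
  field_simp
  ring

end HankelForm

/-! ### Convergence of matrix elements to those of multiplication by f(cos θ). -/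

section CosineMultiplication

open Real Filter Topology
open scoped ComplexConjugate

/-- The indicator function of `(a, ∞)` lies between polynomials that are close in the mean with
respect to the arcsine law. -/
theorem exists_polynomial_approx_indicator_Ioi (a : ℝ) {ε : ℝ} (hε : 0 < ε) :
    ∃ p q : Polynomial ℝ,
      (∀ x ∈ Set.Icc (-1 : ℝ) 1, |(Set.Ioi a).indicator 1 x - p.eval x| ≤ q.eval x) ∧
      ∫ θ in (0 : ℝ)..π, q.eval (cos θ) ≤ ε := by
  -- A bump at a, equal to 1 within 1/(m+1) and 0 beyond 2/(m+1). It dominates the error of the ramp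
  -- `f` below, and its mean tends to 0 because cos θ = a at no more than one angle in [0, π].
  let t : ℕ → ℝ → ℝ := fun m x => max 0 (min 1 (2 - |x - a| * (m + 1)))
  have ht_cont : ∀ m, Continuous (t m) := fun m => by fun_prop
  have ht_lim : Tendsto (fun m : ℕ => ∫ θ in (0 : ℝ)..π, t m (cos θ)) atTop (𝓝 0) := by
    suffices h : Tendsto (fun m : ℕ => ∫ θ in (0 : ℝ)..π, t m (cos θ)) atTop
        (𝓝 (∫ _ in (0 : ℝ)..π, (0 : ℝ))) by rwa [intervalIntegral.integral_zero] at h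
    refine intervalIntegral.tendsto_integral_filter_of_dominated_convergence (fun _ => 1)
      (Eventually.of_forall fun m =>
        ((ht_cont m).comp continuous_cos).aestronglyMeasurable)
      (Eventually.of_forall fun m => Eventually.of_forall fun θ _ => ?_)
      ?_ ?_
    · rw [norm_eq_abs, abs_of_nonneg (le_max_left _ _)]
      exact max_le zero_le_one (min_le_left _ _)
    · exact intervalIntegrable_const
    · have hne : ∀ᵐ θ : ℝ, θ ≠ arccos a := by
        simp [MeasureTheory.ae_iff]
      filter_upwards [hne] with θ hθ hmem
      rw [Set.uIoc_of_le pi_pos.le] at hmem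
      have hpos : 0 < |cos θ - a| := abs_pos.mpr fun h => hθ (by
        rw [← sub_eq_zero.mp h, arccos_cos hmem.1.le hmem.2])
      obtain ⟨m₀, hm₀⟩ := exists_nat_gt (2 / |cos θ - a|)
      refine tendsto_const_nhds.congr' ?_
      filter_upwards [eventually_ge_atTop m₀] with m hm
      have hm' : (m₀ : ℝ) ≤ m := by exact_mod_cast hm
      rw [div_lt_iff₀ hpos] at hm₀
      have : 2 - |cos θ - a| * (m + 1) ≤ 0 := by nlinarith
      exact (max_eq_left ((min_le_right _ _).trans this)).symm
  obtain ⟨m, hm⟩ := (ht_lim.eventually (gt_mem_nhds (half_pos hε))).exists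
  let f : ℝ → ℝ := fun x => max 0 (min 1 ((x - a) * (m + 1)))
  have hf_cont : Continuous f := by fun_prop
  have hft : ∀ x, |(Set.Ioi a).indicator 1 x - f x| ≤ t m x := by
    intro x
    have hm1 : (0 : ℝ) < m + 1 := by positivity
    by_cases hx : x ∈ Set.Ioi a
    · rw [Set.indicator_of_mem hx, Pi.one_apply]
      have hx' : 0 < x - a := sub_pos.mpr hx
      have h0 : 0 ≤ (x - a) * (m + 1) := by positivity
      simp only [f, t, abs_of_pos hx']
      rw [max_eq_right (le_min zero_le_one h0), abs_of_nonneg (by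
        linarith [min_le_left 1 ((x - a) * ((m : ℝ) + 1))])]
      rcases le_total 1 ((x - a) * ((m : ℝ) + 1)) with h1 | h1
      · rw [min_eq_left h1, sub_self]; exact le_max_left _ _
      · rw [min_eq_right h1]
        exact le_max_of_le_right (le_min (by linarith) (by linarith))
    · rw [Set.indicator_of_notMem hx]
      have h0 : (x - a) * (m + 1) ≤ 0 :=
        mul_nonpos_of_nonpos_of_nonneg (sub_nonpos.mpr (not_lt.mp hx)) hm1.le
      simp only [f]
      rw [max_eq_left ((min_le_right _ _).trans h0), sub_self, abs_zero]
      exact le_max_left _ _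
  -- Aiming `q` at t + 2η leaves it above t + η, which absorbs the error of `p`, and below t + 3η,
  -- whose excess integrates to ε/2.
  set η : ℝ := ε / (6 * π) with hη
  have hη0 : 0 < η := by positivity
  obtain ⟨p, hp⟩ := exists_polynomial_near_of_continuousOn (-1) 1 f hf_cont.continuousOn η hη0
  obtain ⟨q, hq⟩ := exists_polynomial_near_of_continuousOn (-1) 1 (fun x => t m x + 2 * η)
    ((ht_cont m).add continuous_const).continuousOn η hη0
  refine ⟨p, q, fun x hx => ?_, ?_⟩
  · have h1 := abs_lt.mp (hp x hx)
    have h2 := abs_lt.mp (hq x hx)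
    have h3 := abs_le.mp (hft x)
    exact abs_le.mpr ⟨by linarith, by linarith⟩
  · have hle : ∫ θ in (0 : ℝ)..π, q.eval (cos θ) ≤ ∫ θ in (0 : ℝ)..π, (t m (cos θ) + 3 * η) := by
      refine intervalIntegral.integral_mono_on pi_pos.le
        (Continuous.intervalIntegrable (by fun_prop) _ _)
        (Continuous.intervalIntegrable (((ht_cont m).comp continuous_cos).add continuous_const)
          _ _) fun θ _ => ?_
      have := abs_lt.mp (hq (cos θ) ⟨neg_one_le_cos θ, cos_le_one θ⟩)
      linarith
    refine hle.trans ?_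
    rw [intervalIntegral.integral_add (f := fun θ => t m (cos θ))
      (((ht_cont m).comp continuous_cos).intervalIntegrable _ _) intervalIntegrable_const,
      intervalIntegral.integral_const]
    have : (π - 0) • (3 * η) = ε / 2 := by
      rw [hη, smul_eq_mul]; field_simp; ring
    rw [this]
    exact (add_le_add_left hm.le _).trans (by linarith)

/-- The matrix elements of `f (cos θ)`, acting by multiplication on `L²` of the circle, in the
Fourier basis. -/
noncomputable def cosFourierCoeff (f : ℝ → ℝ) (d : ℤ) : ℝ :=
  π⁻¹ * ∫ θ in (0 : ℝ)..π, f (cos θ) * cos (d * θ)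

theorem integral_cos_int_mul (d : ℤ) :
    ∫ θ in (0 : ℝ)..π, cos (d * θ) = if d = 0 then π else 0 := by
  split_ifs with h
  · simp [h]
  · have hd : (d : ℝ) ≠ 0 := by exact_mod_cast h
    rw [intervalIntegral.integral_comp_mul_left (fun x => cos x) hd, integral_cos]
    simp [sin_int_mul_pi]

theorem cosFourierCoeff_one (d : ℤ) : cosFourierCoeff 1 d = if d = 0 then 1 else 0 := by
  simp only [cosFourierCoeff, Pi.one_apply, one_mul, integral_cos_int_mul]
  split_ifs
  · exact inv_mul_cancel₀ pi_ne_zero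
  · simp

theorem cosFourierCoeff_add {f g : ℝ → ℝ} (hf : Continuous f) (hg : Continuous g) (d : ℤ) :
    cosFourierCoeff (fun x => f x + g x) d = cosFourierCoeff f d + cosFourierCoeff g d := by
  simp only [cosFourierCoeff, add_mul]
  rw [intervalIntegral.integral_add (Continuous.intervalIntegrable (by fun_prop) _ _)
    (Continuous.intervalIntegrable (by fun_prop) _ _), mul_add]

theorem cosFourierCoeff_const_mul (c : ℝ) (f : ℝ → ℝ) (d : ℤ) :
    cosFourierCoeff (fun x => c * f x) d = c * cosFourierCoeff f d := by
  simp only [cosFourierCoeff, mul_assoc, intervalIntegral.integral_const_mul]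
  ring

/-- The product-to-sum formula: multiplication by cos θ is the Jacobi matrix with off-diagonal
entries 1/2, the limit of the recursion satisfied by the weight vectors. -/
theorem cosFourierCoeff_id_mul {f : ℝ → ℝ} (hf : Continuous f) (d : ℤ) :
    cosFourierCoeff (fun x => x * f x) d =
      1 / 2 * cosFourierCoeff f (d - 1) + 1 / 2 * cosFourierCoeff f (d + 1) := by
  simp only [cosFourierCoeff]
  have : ∀ θ : ℝ, cos θ * f (cos θ) * cos (d * θ) =
      1 / 2 * (f (cos θ) * cos ((d - 1 : ℤ) * θ)) +
        1 / 2 * (f (cos θ) * cos ((d + 1 : ℤ) * θ)) := by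
    intro θ
    push_cast
    rw [sub_mul, add_mul, one_mul, cos_sub, cos_add]
    ring
  simp only [this]
  rw [intervalIntegral.integral_add (Continuous.intervalIntegrable (by fun_prop) _ _)
    (Continuous.intervalIntegrable (by fun_prop) _ _), intervalIntegral.integral_const_mul,
    intervalIntegral.integral_const_mul]
  ring

theorem cosFourierCoeff_indicator_Ioi {a : ℝ} (ha : a ∈ Set.Icc (-1 : ℝ) 1) {d : ℤ} (hd : d ≠ 0) :
    cosFourierCoeff ((Set.Ioi a).indicator 1) d = sin (d * arccos a) / (π * d) := by
  have hd' : (d : ℝ) ≠ 0 := by exact_mod_cast hd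
  have h : ∫ θ in (0 : ℝ)..π, (Set.Ioi a).indicator 1 (cos θ) * cos (d * θ) =
      ∫ θ in (0 : ℝ)..arccos a, cos (d * θ) := by
    rw [intervalIntegral.integral_of_le pi_pos.le, intervalIntegral.integral_of_le
      (arccos_nonneg a), ← MeasureTheory.integral_indicator measurableSet_Ioc,
      ← MeasureTheory.integral_indicator measurableSet_Ioc]
    have hne : ∀ᵐ θ : ℝ, θ ≠ arccos a := by
      simp [MeasureTheory.ae_iff]
    refine MeasureTheory.integral_congr_ae ?_
    filter_upwards [hne] with θ hθ
    by_cases h0 : θ ∈ Set.Ioc 0 π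
    · rw [Set.indicator_of_mem h0]
      have hiff : a < cos θ ↔ θ < arccos a := by
        conv_lhs => rw [← cos_arccos ha.1 ha.2]
        exact strictAntiOn_cos.lt_iff_gt ⟨arccos_nonneg a, arccos_le_pi a⟩ ⟨h0.1.le, h0.2⟩
      by_cases h1 : θ < arccos a
      · rw [Set.indicator_of_mem (show cos θ ∈ Set.Ioi a from hiff.mpr h1),
          Set.indicator_of_mem (show θ ∈ Set.Ioc 0 (arccos a) from ⟨h0.1, h1.le⟩), Pi.one_apply,
          one_mul]
      · rw [Set.indicator_of_notMem (show cos θ ∉ Set.Ioi a from fun h => h1 (hiff.mp h)),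
          Set.indicator_of_notMem (fun h => h1 (lt_of_le_of_ne h.2 hθ)), zero_mul]
    · rw [Set.indicator_of_notMem h0, Set.indicator_of_notMem fun h =>
        h0 ⟨h.1, h.2.trans (arccos_le_pi a)⟩]
  rw [cosFourierCoeff, h, intervalIntegral.integral_comp_mul_left (fun x => cos x) hd',
    integral_cos]
  simp only [mul_zero, sin_zero, sub_zero, smul_eq_mul]
  field_simp

theorem abs_cosFourierCoeff_indicator_sub_le {a : ℝ} {p q : Polynomial ℝ}
    (hpq : ∀ x ∈ Set.Icc (-1 : ℝ) 1, |(Set.Ioi a).indicator 1 x - p.eval x| ≤ q.eval x) (d : ℤ) :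
    |cosFourierCoeff ((Set.Ioi a).indicator 1) d - cosFourierCoeff (fun x => p.eval x) d| ≤
      cosFourierCoeff (fun x => q.eval x) 0 := by
  have hmeas : Measurable ((Set.Ioi a).indicator (1 : ℝ → ℝ)) :=
    measurable_one.indicator measurableSet_Ioi
  have hint : IntervalIntegrable (fun θ => (Set.Ioi a).indicator 1 (cos θ) * cos (d * θ))
      MeasureTheory.volume 0 π := by
    refine (intervalIntegrable_const (c := (1 : ℝ))).mono_fun
      ((hmeas.comp measurable_cos).mul
        (by fun_prop : Measurable fun θ : ℝ => cos (d * θ))).aestronglyMeasurable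
      (Eventually.of_forall fun θ => ?_)
    beta_reduce
    rw [norm_mul, norm_one]
    refine mul_le_one₀ ?_ (norm_nonneg _) (abs_cos_le_one _)
    by_cases h : cos θ ∈ Set.Ioi a
    · simp [Set.indicator_of_mem h]
    · simp [Set.indicator_of_notMem h]
  simp only [cosFourierCoeff, Int.cast_zero, zero_mul, cos_zero, mul_one]
  rw [← mul_sub, ← intervalIntegral.integral_sub hint
    (Continuous.intervalIntegrable (by fun_prop) _ _), abs_mul, abs_of_pos (inv_pos.mpr pi_pos)]
  refine mul_le_mul_of_nonneg_left ?_ (inv_pos.mpr pi_pos).le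
  rw [← norm_eq_abs]
  refine intervalIntegral.norm_integral_le_of_norm_le (g := fun θ => q.eval (cos θ)) pi_pos.le
    (Eventually.of_forall fun θ _ => ?_)
    (Continuous.intervalIntegrable (μ := MeasureTheory.volume) (by fun_prop) _ _)
  rw [← sub_mul, norm_mul]
  refine (mul_le_of_le_one_right (norm_nonneg _) (abs_cos_le_one _)).trans ?_
  exact hpq _ ⟨neg_one_le_cos θ, cos_le_one θ⟩

section MatrixElements

variable {ι : ℕ → Type*} [∀ n, Fintype (ι n)] {μ : ∀ n, ι n → ℝ} {c : ∀ n, ℤ → ι n → ℂ}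
  {γ γ' : ℕ → ℤ → ℝ}

/-- Here `c n l` holds the coordinates of the l-th vector in an eigenbasis with eigenvalues `μ n`.
Each factor μ is absorbed by the recursion, which moves l to l ± 1; hence the induction on the power
runs over all l at once. The limits obey the same recursion, with orthonormality as the initial
value. -/
theorem tendsto_sum_polynomial
    (horth : ∀ k l, ∀ᶠ n in atTop, ∑ i, conj (c n k i) * c n l i = if k = l then 1 else 0)
    (hrec : ∀ l, ∀ᶠ n in atTop, ∀ i, (μ n i : ℂ) * c n l i =
      γ n l * c n (l + 1) i + γ' n l * c n (l - 1) i)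
    (hγ : ∀ l, Tendsto (fun n => γ n l) atTop (𝓝 (1 / 2)))
    (hγ' : ∀ l, Tendsto (fun n => γ' n l) atTop (𝓝 (1 / 2))) (p : Polynomial ℝ) (k l : ℤ) :
    Tendsto (fun n => ∑ i, ((p.eval (μ n i) : ℝ) : ℂ) * (conj (c n k i) * c n l i)) atTop
      (𝓝 (cosFourierCoeff (fun x => p.eval x) (k - l) : ℝ)) := by
  have hmono : ∀ (r : ℕ) (l : ℤ),
      Tendsto (fun n => ∑ i, ((μ n i ^ r : ℝ) : ℂ) * (conj (c n k i) * c n l i)) atTop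
        (𝓝 (cosFourierCoeff (fun x => x ^ r) (k - l) : ℝ)) := by
    intro r
    induction r with
    | zero =>
      intro l
      have h1 : (fun x : ℝ => x ^ 0) = 1 := by ext; simp
      rw [h1, cosFourierCoeff_one]
      refine tendsto_const_nhds.congr' ?_
      filter_upwards [horth k l] with n hn
      simp only [pow_zero, Complex.ofReal_one, one_mul, hn, sub_eq_zero]
      split_ifs <;> simp
    | succ r ih =>
      intro l
      simp only [pow_succ']
      rw [cosFourierCoeff_id_mul (by fun_prop)]
      have e1 : k - l - 1 = k - (l + 1) := by ring
      have e2 : k - l + 1 = k - (l - 1) := by ring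
      have hl := (((Complex.continuous_ofReal.tendsto _).comp (hγ l)).mul (ih (l + 1))).add
        (((Complex.continuous_ofReal.tendsto _).comp (hγ' l)).mul (ih (l - 1)))
      rw [e1, e2]
      push_cast at hl ⊢
      refine hl.congr' ?_
      filter_upwards [hrec l] with n hn
      simp only [Function.comp_apply, Finset.mul_sum, ← Finset.sum_add_distrib]
      refine Finset.sum_congr rfl fun i _ => ?_
      linear_combination (-(μ n i : ℂ) ^ r * conj (c n k i)) * hn i
  induction p using Polynomial.induction_on' with
  | add p q hp hq =>
    have := hp.add hq
    simp only [Polynomial.eval_add]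
    rw [cosFourierCoeff_add (by fun_prop) (by fun_prop)]
    push_cast
    refine this.congr fun n => ?_
    simp only [add_mul, Finset.sum_add_distrib]
  | monomial r b =>
    have := (hmono r l).const_mul (b : ℂ)
    simp only [Polynomial.eval_monomial]
    rw [cosFourierCoeff_const_mul]
    push_cast at this ⊢
    refine this.congr fun n => ?_
    rw [Finset.mul_sum]
    exact Finset.sum_congr rfl fun i _ => by ring

/-- By 2|xy| ≤ |x|² + |y|², the off-diagonal error is controlled by diagonal elements of the
majorant q, for which polynomial convergence is available. -/
theorem norm_sum_sub_sum_le {ι : Type*} [Fintype ι] {μ : ι → ℝ} {f g q : ℝ → ℝ}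
    (hfg : ∀ i, |f (μ i) - g (μ i)| ≤ q (μ i)) (x y : ι → ℂ) :
    ‖∑ i, (f (μ i) : ℂ) * (conj (x i) * y i) - ∑ i, (g (μ i) : ℂ) * (conj (x i) * y i)‖ ≤
      1 / 2 * ‖∑ i, (q (μ i) : ℂ) * (conj (x i) * x i)‖ +
      1 / 2 * ‖∑ i, (q (μ i) : ℂ) * (conj (y i) * y i)‖ := by
  have hq : ∀ i, 0 ≤ q (μ i) := fun i => (abs_nonneg _).trans (hfg i)
  have hdiag : ∀ z : ι → ℂ,
      ‖∑ i, (q (μ i) : ℂ) * (conj (z i) * z i)‖ = ∑ i, q (μ i) * ‖z i‖ ^ 2 := by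
    intro z
    have : ∑ i, (q (μ i) : ℂ) * (conj (z i) * z i) =
        ((∑ i, q (μ i) * ‖z i‖ ^ 2 : ℝ) : ℂ) := by
      push_cast
      exact Finset.sum_congr rfl fun i _ => by rw [Complex.conj_mul']
    rw [this, Complex.norm_real, norm_eq_abs, abs_of_nonneg
      (Finset.sum_nonneg fun i _ => mul_nonneg (hq i) (sq_nonneg _))]
  rw [hdiag, hdiag, ← Finset.sum_sub_distrib, Finset.mul_sum, Finset.mul_sum,
    ← Finset.sum_add_distrib]
  refine norm_sum_le_of_le _ fun i _ => ?_
  rw [← sub_mul, ← Complex.ofReal_sub, norm_mul, norm_mul, Complex.norm_real, norm_eq_abs,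
    RCLike.norm_conj]
  have h1 : ‖x i‖ * ‖y i‖ ≤ 1 / 2 * (‖x i‖ ^ 2 + ‖y i‖ ^ 2) := by
    nlinarith [sq_nonneg (‖x i‖ - ‖y i‖)]
  calc _ ≤ q (μ i) * (1 / 2 * (‖x i‖ ^ 2 + ‖y i‖ ^ 2)) :=
        mul_le_mul (hfg i) h1 (by positivity) (hq i)
    _ = _ := by ring

/-- The indicator is discontinuous, so uniform approximation fails; an approximant `p` with
polynomial error majorant `q` of small mean suffices. The bound on `μ` keeps the eigenvalues where
the majorant is valid. -/
theorem tendsto_sum_indicator_Ioi (hμ : ∀ n i, μ n i ∈ Set.Icc (-1 : ℝ) 1)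
    (horth : ∀ k l, ∀ᶠ n in atTop, ∑ i, conj (c n k i) * c n l i = if k = l then 1 else 0)
    (hrec : ∀ l, ∀ᶠ n in atTop, ∀ i, (μ n i : ℂ) * c n l i =
      γ n l * c n (l + 1) i + γ' n l * c n (l - 1) i)
    (hγ : ∀ l, Tendsto (fun n => γ n l) atTop (𝓝 (1 / 2)))
    (hγ' : ∀ l, Tendsto (fun n => γ' n l) atTop (𝓝 (1 / 2))) (a : ℝ) (k l : ℤ) :
    Tendsto (fun n => ∑ i, (((Set.Ioi a).indicator (1 : ℝ → ℝ) (μ n i) : ℝ) : ℂ) *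
        (conj (c n k i) * c n l i)) atTop
      (𝓝 (cosFourierCoeff ((Set.Ioi a).indicator 1) (k - l) : ℝ)) := by
  rw [Metric.tendsto_nhds]
  intro ε hε
  obtain ⟨p, q, hpq, hq⟩ := exists_polynomial_approx_indicator_Ioi a
    (by positivity : 0 < π * (ε / 8))
  have hL : ∀ d, |cosFourierCoeff ((Set.Ioi a).indicator 1) d -
      cosFourierCoeff (fun x => p.eval x) d| ≤ ε / 8 := by
    intro d
    refine (abs_cosFourierCoeff_indicator_sub_le hpq d).trans ?_
    rw [cosFourierCoeff, inv_mul_le_iff₀ pi_pos]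
    simpa using hq
  have hq0 : |cosFourierCoeff (fun x => q.eval x) 0| ≤ ε / 8 := by
    rw [abs_of_nonneg ((abs_nonneg _).trans (abs_cosFourierCoeff_indicator_sub_le hpq 0)),
      cosFourierCoeff, inv_mul_le_iff₀ pi_pos]
    simpa using hq
  have hdiag : ∀ k, ∀ᶠ n in atTop,
      ‖∑ i, ((q.eval (μ n i) : ℝ) : ℂ) * (conj (c n k i) * c n k i)‖ < ε / 4 := by
    intro k
    have h := (tendsto_sum_polynomial horth hrec hγ hγ' q k k).norm
    rw [sub_self, Complex.norm_real, norm_eq_abs] at h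
    exact h.eventually (gt_mem_nhds (by linarith))
  have hp := (tendsto_sum_polynomial horth hrec hγ hγ' p k l).eventually
    (Metric.ball_mem_nhds _ (by positivity : 0 < ε / 4))
  filter_upwards [hdiag k, hdiag l, hp] with n h1 h2 h3
  have h4 := norm_sum_sub_sum_le (μ := μ n) (f := (Set.Ioi a).indicator 1)
    (g := fun x => p.eval x) (q := fun x => q.eval x) (fun i => hpq _ (hμ n i)) (c n k) (c n l)
  have h5 := hL (k - l)
  rw [abs_sub_comm, ← norm_eq_abs, ← Complex.norm_real, Complex.ofReal_sub,
    ← dist_eq_norm] at h5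
  rw [← dist_eq_norm] at h4
  refine (dist_triangle4 _ _ _ _).trans_lt
    (lt_of_le_of_lt (add_le_add (add_le_add h4 h3.le) h5) ?_)
  linarith

end MatrixElements

end CosineMultiplication

/-! ### Weight vectors near the equator. -/

section EquatorialLimit

open Module Real Filter Topology
open scoped ComplexConjugate

theorem IsIrreducibleSpin.exists_eigenbasis {V : Type*} [NormedAddCommGroup V]
    [InnerProductSpace ℂ V] [FiniteDimensional ℂ V] {Jx Jy Jz : V →ₗ[ℂ] V}
    (h : IsIrreducibleSpin Jx Jy Jz) :
    ∃ w : OrthonormalBasis (Fin (finrank ℂ V)) ℂ V,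
      ∀ i, Jz (w i) = ((((finrank ℂ V : ℝ) - 1) / 2 - (i : ℕ) : ℝ) : ℂ) • w i := by
  obtain ⟨v, hv, hz, -⟩ := h.exists_weight_vectors
  have hon : Orthonormal ℂ fun i : Fin (finrank ℂ V) => v i := by
    rw [orthonormal_iff_ite]
    intro i k
    rw [hv i k i.2 k.2]
    simp only [Fin.ext_iff]
  have := h.nontrivial
  have : Nonempty (Fin (finrank ℂ V)) := ⟨⟨0, finrank_pos⟩⟩
  let B := basisOfOrthonormalOfCardEqFinrank hon (by simp)
  have hB : (B : Fin (finrank ℂ V) → V) = fun i : Fin (finrank ℂ V) => v i :=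
    coe_basisOfOrthonormalOfCardEqFinrank hon (by simp)
  refine ⟨B.toOrthonormalBasis (by rwa [hB]), fun i => ?_⟩
  rw [Module.Basis.coe_toOrthonormalBasis, hB]
  exact hz i

theorem inner_spectralProjection_eq_sum {V : Type*} [NormedAddCommGroup V]
    [InnerProductSpace ℂ V] [FiniteDimensional ℂ V] {A : V →ₗ[ℂ] V} (hA : A.IsSymmetric)
    {ι : Type*} [Fintype ι] (w : OrthonormalBasis ι ℂ V) {ν : ι → ℝ}
    (hw : ∀ i, A (w i) = (ν i : ℂ) • w i) (I : Set ℝ) (x y : V) :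
    inner ℂ x (spectralProjection A I y) =
      ∑ i, ((I.indicator (1 : ℝ → ℝ) (ν i) : ℝ) : ℂ) *
        (conj (inner ℂ (w i) x) * inner ℂ (w i) y) := by
  rw [← w.sum_inner_mul_inner]
  refine Finset.sum_congr rfl fun i _ => ?_
  have hsymm : inner ℂ (w i) (spectralProjection A I y) =
      inner ℂ (spectralProjection A I (w i)) y :=
    (Submodule.inner_starProjection_left_eq_right _ _ _).symm
  rw [hsymm, inner_conj_symm]
  by_cases hi : ν i ∈ I
  · rw [spectralProjection_apply_of_mem hi (hw i), Set.indicator_of_mem hi]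
    simp
  · rw [spectralProjection_apply_of_notMem hA hi (hw i), Set.indicator_of_notMem hi]
    simp

theorem tendsto_div_of_abs_sub_half_le {x : ℕ → ℝ} {C : ℝ}
    (hx : ∀ n : ℕ, |x n - ((n : ℝ) + 1) / 2| ≤ C) :
    Tendsto (fun n : ℕ => x n / ((n : ℝ) + 1)) atTop (𝓝 (1 / 2)) := by
  rw [tendsto_iff_norm_sub_tendsto_zero]
  have hC : Tendsto (fun n : ℕ => C / ((n : ℝ) + 1)) atTop (𝓝 0) :=
    tendsto_const_nhds.div_atTop (tendsto_atTop_add_const_right _ _ tendsto_natCast_atTop_atTop)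
  refine squeeze_zero (fun _ => norm_nonneg _) (fun n => ?_) hC
  have hn : (0 : ℝ) < (n : ℝ) + 1 := by positivity
  have e : x n / ((n : ℝ) + 1) - 1 / 2 = (x n - ((n : ℝ) + 1) / 2) / ((n : ℝ) + 1) := by
    field_simp
  rw [e, norm_div, norm_of_nonneg hn.le]
  exact div_le_div_of_nonneg_right (hx n) hn.le

/-- Near the equator both factors under the root in a Jacobi entry are (n+1)/2 + O(1), so the
rescaled entries tend to 1/2. -/
theorem tendsto_sqrt_mul_div_of_abs_sub_half_le {x y : ℕ → ℝ} {C : ℝ}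
    (hx : ∀ n : ℕ, |x n - ((n : ℝ) + 1) / 2| ≤ C) (hy : ∀ n : ℕ, |y n - ((n : ℝ) + 1) / 2| ≤ C) :
    Tendsto (fun n : ℕ => √(x n * y n) / ((n : ℝ) + 1)) atTop (𝓝 (1 / 2)) := by
  have h := ((tendsto_div_of_abs_sub_half_le hx).mul (tendsto_div_of_abs_sub_half_le hy)).sqrt
  rw [sqrt_mul_self (by norm_num)] at h
  refine h.congr fun n => ?_
  have hn : (0 : ℝ) < (n : ℝ) + 1 := by positivity
  rw [div_mul_div_comm, sqrt_div' _ (by positivity), sqrt_mul_self hn.le]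

/-- Weight vectors of `Jz` with weights near `0`, indexed by their distance from the equator. As the
dimension grows, the spectral projection of `Jx` acts on them as multiplication by the indicator
function of `{θ | a < cos θ}` acts on the Fourier basis of the circle. -/
theorem exists_equatorial_vectors (a : ℝ) {b : ℝ} (hb : 0 < b)
    {V : ℕ → Type*} [∀ n, NormedAddCommGroup (V n)] [∀ n, InnerProductSpace ℂ (V n)]
    [∀ n, FiniteDimensional ℂ (V n)] (hV : ∀ n, finrank ℂ (V n) = n + 1)
    {Jx Jy Jz : ∀ n, V n →ₗ[ℂ] V n} (hJ : ∀ n, IsIrreducibleSpin (Jx n) (Jy n) (Jz n)) :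
    ∃ e : ∀ n, ℤ → V n,
      (∀ k l, ∀ᶠ n in atTop, inner ℂ (e n k) (e n l) = if k = l then (1 : ℂ) else 0) ∧
      (∀ k, 0 ≤ k → ∀ᶠ n : ℕ in atTop,
        spectralProjection (Jz n) (Set.Ioc 0 (b * (((n : ℝ) + 1) / 2))) (e n k) = 0) ∧
      (∀ k, k < 0 → ∀ᶠ n : ℕ in atTop,
        spectralProjection (Jz n) (Set.Ioc 0 (b * (((n : ℝ) + 1) / 2))) (e n k) = e n k) ∧
      (∀ k l, Tendsto (fun n : ℕ => inner ℂ (e n k)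
          (spectralProjection (Jx n) (Set.Ioi (a * (((n : ℝ) + 1) / 2))) (e n l))) atTop
        (𝓝 (cosFourierCoeff ((Set.Ioi a).indicator 1) (k - l) : ℝ))) := by
  choose v hv hvz hvx using fun n => (hJ n).exists_weight_vectors
  choose w hw using fun n => (hJ n).cyclic.exists_eigenbasis
  have hVr : ∀ n, (finrank ℂ (V n) : ℝ) = (n : ℝ) + 1 := fun n => by rw [hV]; push_cast; rfl
  -- Ladder position; the weight there is n/2 - s. Rounding (n+1)/2 down makes the weight positive
  -- exactly when k < 0, for either parity of n.
  let s : ℕ → ℤ → ℤ := fun n k => (((n + 1) / 2 : ℕ) : ℤ) + k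
  have hs : ∀ k : ℤ, ∀ᶠ n : ℕ in atTop, ∃ i : ℕ, s n k = i + 1 ∧ i + 2 < n + 1 := by
    intro k
    filter_upwards [eventually_ge_atTop (2 * k.natAbs + 10)] with n hn
    refine ⟨(s n k - 1).toNat, ?_, ?_⟩ <;> simp only [s] <;> omega
  have hs_half : ∀ (n : ℕ) (k : ℤ), |(s n k : ℝ) - ((n : ℝ) + 1) / 2| ≤ |(k : ℝ)| + 1 := by
    intro n k
    have h1 : (((n + 1) / 2 : ℕ) : ℝ) ≤ ((n : ℝ) + 1) / 2 := by
      rw [le_div_iff₀ two_pos]; exact_mod_cast Nat.div_mul_le_self _ _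
    have h2 : ((n : ℝ) + 1) / 2 ≤ (((n + 1) / 2 : ℕ) : ℝ) + 1 := by
      rw [div_le_iff₀ two_pos]; exact_mod_cast (by omega : n + 1 ≤ ((n + 1) / 2 + 1) * 2)
    have h3 := abs_le.mp (le_refl |(k : ℝ)|)
    have h4 : (s n k : ℝ) = (((n + 1) / 2 : ℕ) : ℝ) + k := by
      simp only [s, Int.cast_add, Int.cast_natCast]
    rw [h4]
    exact abs_le.mpr ⟨by linarith, by linarith⟩
  -- The truncation in `toNat` is harmless: for fixed k the position is eventually positive.
  let e : ∀ n, ℤ → V n := fun n k => v n (s n k).toNat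
  have horth : ∀ k l, ∀ᶠ n in atTop, inner ℂ (e n k) (e n l) = if k = l then (1 : ℂ) else 0 := by
    intro k l
    filter_upwards [hs k, hs l] with n ⟨i, hi, hi'⟩ ⟨i', hk, hk'⟩
    have e1 : (s n k).toNat < finrank ℂ (V n) := by rw [hV]; omega
    have e2 : (s n l).toNat < finrank ℂ (V n) := by rw [hV]; omega
    have hiff : (s n k).toNat = (s n l).toNat ↔ k = l := by simp only [s] at *; omega
    simp only [e, hv n _ _ e1 e2, hiff]
  have hez : ∀ k, ∀ᶠ n : ℕ in atTop,
      Jz n (e n k) = (((n : ℝ) / 2 - s n k : ℝ) : ℂ) • e n k := by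
    intro k
    filter_upwards [hs k] with n ⟨i, hi, _⟩
    simp only [e]
    rw [hvz, hVr, hi]
    have : ((i : ℤ) + 1).toNat = i + 1 := by omega
    rw [this]
    push_cast
    ring_nf
  let μ : ∀ n, Fin (finrank ℂ (V n)) → ℝ := fun n i =>
    (((finrank ℂ (V n) : ℝ) - 1) / 2 - (i : ℕ)) / (((n : ℝ) + 1) / 2)
  have hμ : ∀ n i, μ n i ∈ Set.Icc (-1 : ℝ) 1 := by
    intro n i
    have hi : ((i : ℕ) : ℝ) ≤ n := by
      exact_mod_cast Nat.lt_succ_iff.mp (i.2.trans_eq (hV n))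
    have hi0 : (0 : ℝ) ≤ ((i : ℕ) : ℝ) := by positivity
    have hn : (0 : ℝ) < ((n : ℝ) + 1) / 2 := by positivity
    simp only [μ, hVr]
    exact ⟨by rw [le_div_iff₀ hn]; linarith, by rw [div_le_iff₀ hn]; linarith⟩
  let c : ∀ n, ℤ → Fin (finrank ℂ (V n)) → ℂ := fun n l i => inner ℂ (w n i) (e n l)
  let γ : ℕ → ℤ → ℝ := fun n l => √(((s n l : ℝ) + 1) * ((n : ℝ) - s n l)) / ((n : ℝ) + 1)
  let γ' : ℕ → ℤ → ℝ := fun n l => √((s n l : ℝ) * ((n : ℝ) + 1 - s n l)) / ((n : ℝ) + 1)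
  have hγ : ∀ l, Tendsto (fun n => γ n l) atTop (𝓝 (1 / 2)) := fun l =>
    tendsto_sqrt_mul_div_of_abs_sub_half_le (C := |(l : ℝ)| + 2)
      (fun n => by
        have := abs_le.mp (hs_half n l)
        exact abs_le.mpr ⟨by linarith, by linarith⟩)
      (fun n => by
        have := abs_le.mp (hs_half n l)
        exact abs_le.mpr ⟨by linarith, by linarith⟩)
  have hγ' : ∀ l, Tendsto (fun n => γ' n l) atTop (𝓝 (1 / 2)) := fun l =>
    tendsto_sqrt_mul_div_of_abs_sub_half_le (C := |(l : ℝ)| + 2)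
      (fun n => by
        have := abs_le.mp (hs_half n l)
        exact abs_le.mpr ⟨by linarith, by linarith⟩)
      (fun n => by
        have := abs_le.mp (hs_half n l)
        exact abs_le.mpr ⟨by linarith, by linarith⟩)
  have hrec : ∀ l, ∀ᶠ n in atTop, ∀ i, (μ n i : ℂ) * c n l i =
      γ n l * c n (l + 1) i + γ' n l * c n (l - 1) i := by
    intro l
    filter_upwards [hs l] with n ⟨r, hr, _⟩ i
    have hn : ((n : ℝ) + 1) ≠ 0 := by positivity
    have hwi : inner ℂ (w n i) (Jx n (e n l)) =
        ((((finrank ℂ (V n) : ℝ) - 1) / 2 - (i : ℕ) : ℝ) : ℂ) * inner ℂ (w n i) (e n l) := by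
      rw [← (hJ n).symm_x, hw, inner_smul_left, Complex.conj_ofReal]
    have t0 : (s n l).toNat = r + 1 := by omega
    have t1 : (s n (l + 1)).toNat = r + 2 := by simp only [s] at *; omega
    have t2 : (s n (l - 1)).toNat = r := by simp only [s] at *; omega
    have hx : Jx n (e n l) = ((((n : ℝ) + 1) / 2 * γ' n l : ℝ) : ℂ) • e n (l - 1) +
        ((((n : ℝ) + 1) / 2 * γ n l : ℝ) : ℂ) • e n (l + 1) := by
      simp only [e, t0, t1, t2]
      rw [hvx]
      have hsr : (s n l : ℝ) = r + 1 := by rw [hr]; push_cast; rfl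
      congr 3
      · simp only [γ', hsr, hVr]
        field_simp
        congr 2
        ring
      · simp only [γ, hsr, hVr]
        field_simp
        congr 1
        ring
    rw [hx, inner_add_right, inner_smul_right, inner_smul_right] at hwi
    have hnC : ((((n : ℝ) + 1) / 2 : ℝ) : ℂ) ≠ 0 := by
      exact_mod_cast (by positivity : ((n : ℝ) + 1) / 2 ≠ 0)
    simp only [c, μ]
    rw [Complex.ofReal_div, div_mul_eq_mul_div, ← hwi, div_eq_iff hnC]
    rw [Complex.ofReal_mul, Complex.ofReal_mul]
    ring
  have hcorth : ∀ k l, ∀ᶠ n in atTop,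
      ∑ i, conj (c n k i) * c n l i = if k = l then 1 else 0 := by
    intro k l
    filter_upwards [horth k l] with n hn
    rw [← hn, ← (w n).sum_inner_mul_inner]
    simp only [c, inner_conj_symm]
  refine ⟨e, horth, fun k hk => ?_, fun k hk => ?_, fun k l => ?_⟩
  · filter_upwards [hez k] with n hn
    refine spectralProjection_apply_of_notMem (hJ n).symm_z (fun hmem => ?_) hn
    have h1 : (n : ℤ) ≤ 2 * s n k := by simp only [s]; omega
    have h2 : (n : ℝ) ≤ 2 * s n k := by exact_mod_cast h1
    linarith [hmem.1]
  -- The weight is at most -k, so the growing upper cutoff is eventually irrelevant; this is why b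
  -- leaves no trace in the limit.
  · have hlarge : ∀ᶠ n : ℕ in atTop, (-(k : ℝ)) ≤ b * (((n : ℝ) + 1) / 2) := by
      have : Tendsto (fun n : ℕ => b * (((n : ℝ) + 1) / 2)) atTop atTop :=
        ((tendsto_atTop_add_const_right _ _ tendsto_natCast_atTop_atTop).atTop_div_const
          two_pos).const_mul_atTop hb
      exact this.eventually_ge_atTop _
    filter_upwards [hez k, hlarge] with n hn hn'
    refine spectralProjection_apply_of_mem (Set.mem_Ioc.mpr ⟨?_, ?_⟩) hn
    · have h1 : 2 * s n k < (n : ℤ) := by simp only [s]; omega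
      have h2 : 2 * (s n k : ℝ) < n := by exact_mod_cast h1
      linarith
    · have h1 : (n : ℤ) ≤ 2 * s n k - 2 * k := by simp only [s]; omega
      have h2 : (n : ℝ) ≤ 2 * s n k - 2 * k := by exact_mod_cast h1
      linarith
  · refine (tendsto_sum_indicator_Ioi hμ hcorth hrec hγ hγ' a k l).congr fun n => ?_
    rw [inner_spectralProjection_eq_sum (hJ n).symm_x (w n) (hw n)]
    refine Finset.sum_congr rfl fun i _ => ?_
    have hn : (0 : ℝ) < ((n : ℝ) + 1) / 2 := by positivity
    have hiff : μ n i ∈ Set.Ioi a ↔ ((finrank ℂ (V n) : ℝ) - 1) / 2 - (i : ℕ) ∈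
        Set.Ioi (a * (((n : ℝ) + 1) / 2)) := by
      simp only [μ, Set.mem_Ioi, lt_div_iff₀ hn]
    simp only [Set.indicator_apply, hiff, c, Pi.one_apply]

end EquatorialLimit

/-! ### Trial vectors and the main theorem. -/

open Module Real Filter Topology
open scoped ComplexConjugate

theorem norm_sum_smul_sq {V : Type*} [NormedAddCommGroup V] [InnerProductSpace ℂ V] {N : ℕ}
    {f : ℕ → V} (hf : ∀ k < N, ∀ l < N, inner ℂ (f k) (f l) = if k = l then (1 : ℂ) else 0)
    (g : ℕ → ℂ) :
    ‖∑ k ∈ Finset.range N, g k • f k‖ ^ 2 = ∑ k ∈ Finset.range N, ‖g k‖ ^ 2 := by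
  have h : inner ℂ (∑ k ∈ Finset.range N, g k • f k) (∑ k ∈ Finset.range N, g k • f k) =
      ((∑ k ∈ Finset.range N, ‖g k‖ ^ 2 : ℝ) : ℂ) := by
    simp only [sum_inner, inner_sum, inner_smul_left, inner_smul_right]
    push_cast
    refine Finset.sum_congr rfl fun k hk => ?_
    rw [Finset.sum_eq_single k]
    · rw [hf k (Finset.mem_range.mp hk) k (Finset.mem_range.mp hk), if_pos rfl, mul_one,
        Complex.mul_conj']
    · intro l hl hlk
      rw [hf l (Finset.mem_range.mp hl) k (Finset.mem_range.mp hk), if_neg hlk]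
      simp
    · exact fun h => absurd hk h
  rw [inner_self_eq_norm_sq_to_K] at h
  refine Complex.ofReal_injective ?_
  rw [← h]
  push_cast
  rfl

/-- A lower bound for the norm of a commutator from a pair of vectors, one in the range and one in
the kernel of the second projection. -/
theorem norm_inner_le_norm_commutator_mul {V : Type*} [NormedAddCommGroup V]
    [InnerProductSpace ℂ V] (P : V →L[ℂ] V) (U : Submodule ℂ V) [U.HasOrthogonalProjection]
    {y z : V} (hy : U.starProjection y = y) (hz : U.starProjection z = 0) :
    ‖inner ℂ z (P y)‖ ≤ ‖P * U.starProjection - U.starProjection * P‖ * (‖z‖ * ‖y‖) := by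
  have h : inner ℂ z (P y) = inner ℂ z ((P * U.starProjection - U.starProjection * P) y) := by
    rw [sub_apply, mul_apply_eq_comp,
      mul_apply_eq_comp, hy, inner_sub_right,
      ← Submodule.inner_starProjection_left_eq_right, hz, inner_zero_left, sub_zero]
  rw [h]
  refine (norm_inner_le_norm _ _).trans ?_
  rw [mul_left_comm]
  exact mul_le_mul_of_nonneg_left (ContinuousLinearMap.le_opNorm _ _) (norm_nonneg _)

theorem spinCommutator_eq {V : Type*} [NormedAddCommGroup V] [InnerProductSpace ℂ V]
    [FiniteDimensional ℂ V] {n : ℕ} (hV : finrank ℂ V = n + 1) (a b : ℝ) (Jx Jz : V →ₗ[ℂ] V) :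
    spinCommutator a b Jx Jz =
      spectralProjection Jx (Set.Ioi (a * (((n : ℝ) + 1) / 2))) *
        spectralProjection Jz (Set.Ioc 0 (b * (((n : ℝ) + 1) / 2))) -
      spectralProjection Jz (Set.Ioc 0 (b * (((n : ℝ) + 1) / 2))) *
        spectralProjection Jx (Set.Ioi (a * (((n : ℝ) + 1) / 2))) := by
  have h : spinNumber (finrank ℂ V) + 1 / 2 = ((n : ℝ) + 1) / 2 := by
    rw [spinNumber, hV]; push_cast; ring
  simp only [spinCommutator, h]

theorem norm_spinCommutator_le {V : Type*} [NormedAddCommGroup V] [InnerProductSpace ℂ V]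
    [FiniteDimensional ℂ V] (a b : ℝ) (Jx Jz : V →ₗ[ℂ] V) :
    ‖spinCommutator a b Jx Jz‖ ≤ 1 / 2 :=
  norm_commutator_starProjection_le _ _

/-- The coefficients `exp (i φ) / √(k + 1)` of the trial vectors. -/
noncomputable def trialCoeff (φ : ℝ) (k : ℕ) : ℂ :=
  ((1 / √((k : ℝ) + 1) : ℝ) : ℂ) * Complex.exp (φ * Complex.I)

theorem norm_trialCoeff_sq (φ : ℝ) (k : ℕ) : ‖trialCoeff φ k‖ ^ 2 = 1 / ((k : ℝ) + 1) := by
  rw [trialCoeff, norm_mul, Complex.norm_exp_ofReal_mul_I, mul_one, Complex.norm_real,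
    norm_eq_abs, sq_abs, div_pow, one_pow, sq_sqrt (by positivity)]

theorem im_conj_trialCoeff_mul_mul (φ ψ t : ℝ) (k l : ℕ) :
    (conj (trialCoeff φ k) * (trialCoeff ψ l * (t : ℂ))).im =
      1 / √((k : ℝ) + 1) * (1 / √((l : ℝ) + 1)) * (sin (ψ - φ) * t) := by
  have h : conj (trialCoeff φ k) * (trialCoeff ψ l * (t : ℂ)) =
      ((1 / √((k : ℝ) + 1) * (1 / √((l : ℝ) + 1)) * t : ℝ) : ℂ) *
        Complex.exp ((ψ - φ : ℝ) * Complex.I) := by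
    simp only [trialCoeff, map_mul, Complex.conj_ofReal, ← Complex.exp_conj, Complex.conj_I]
    have e : Complex.exp ((ψ - φ : ℝ) * Complex.I) =
        Complex.exp (φ * -Complex.I) * Complex.exp (ψ * Complex.I) := by
      rw [← Complex.exp_add]
      push_cast
      ring_nf
    rw [e]
    push_cast
    ring
  rw [h, Complex.im_ofReal_mul, Complex.exp_ofReal_mul_I_im]
  ring

theorem mainTheorem3 (a b : ℝ) (ha : a ∈ Set.Ico (0 : ℝ) 1) (hb : b ∈ Set.Ioc (0 : ℝ) 1)
    (V : ℕ → Type*) [∀ n, NormedAddCommGroup (V n)] [∀ n, InnerProductSpace ℂ (V n)]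
    [∀ n, FiniteDimensional ℂ (V n)] (hV : ∀ n, 1 ≤ n → Module.finrank ℂ (V n) = n)
    (Jx Jy Jz : ∀ n, V n →ₗ[ℂ] V n)
    (hJ : ∀ n, 1 ≤ n → IsIrreducibleSpin (Jx n) (Jy n) (Jz n)) :
    Filter.Tendsto (fun n : ℕ => ‖spinCommutator a b (Jx n) (Jz n)‖) Filter.atTop
      (nhds (1 / 2)) := by
  -- Dimension n + 1 from here on, since nothing is assumed of `V 0`.
  rw [← tendsto_add_atTop_iff_nat 1]
  refine tendsto_order.mpr ⟨fun x hx => ?_, fun x hx =>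
    Eventually.of_forall fun n => (norm_spinCommutator_le _ _ _ _).trans_lt hx⟩
  have hV' : ∀ n, finrank ℂ (V (n + 1)) = n + 1 := fun n => hV _ n.succ_pos
  obtain ⟨e, horth, hQ0, hQ1, hP⟩ := exists_equatorial_vectors a hb.1
    (V := fun n => V (n + 1)) hV' (fun n => hJ (n + 1) n.succ_pos)
  set α := arccos a with hα
  have hsin : 0 < sin α := by
    rw [hα, sin_arccos]
    exact sqrt_pos.mpr (by nlinarith [ha.1, ha.2])
  obtain ⟨C, hC⟩ := exists_hankel_form_lower_bound hsin
  -- The harmonic sum H satisfies (1/2 - x)H > C, so H/2 - C > xH; H > 0 permits the final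
  -- cancellation.
  obtain ⟨N, hN, hN0⟩ := ((tendsto_sum_range_one_div_nat_succ_atTop.eventually_gt_atTop
    (C / (1 / 2 - x))).and (tendsto_sum_range_one_div_nat_succ_atTop.eventually_gt_atTop 0)).exists
  have hCN := hC N
  set H := ∑ k ∈ Finset.range N, 1 / ((k : ℝ) + 1) with hH
  rw [div_lt_iff₀ (by linarith)] at hN
  -- `y` uses frequencies -(l+1), in the range of the `Jz` projection, and `z` uses frequencies k ≥
  -- 0, in its kernel. The frequency difference is s = k + l + 1 and the phase difference is sα, so
  -- the imaginary part contributes the second factor sin(sα).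
  let y : ∀ n, V (n + 1) := fun n =>
    ∑ l ∈ Finset.range N, trialCoeff (α * l) l • e n (-((l : ℤ) + 1))
  let z : ∀ n, V (n + 1) := fun n =>
    ∑ k ∈ Finset.range N, trialCoeff (-(α * (k + 1))) k • e n k
  have hy : ∀ᶠ n in atTop, ‖y n‖ ^ 2 = H := by
    have : ∀ᶠ n in atTop, ∀ k ∈ Finset.range N, ∀ l ∈ Finset.range N,
        inner ℂ (e n (-((k : ℤ) + 1))) (e n (-((l : ℤ) + 1))) = if k = l then (1 : ℂ) else 0 := by
      simp only [Filter.eventually_all_finset]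
      intro k _ l _
      filter_upwards [horth (-((k : ℤ) + 1)) (-((l : ℤ) + 1))] with n hn
      rw [hn]
      simp
    filter_upwards [this] with n hn
    rw [norm_sum_smul_sq fun k hk l hl => hn k (Finset.mem_range.mpr hk) l (Finset.mem_range.mpr hl)]
    simp only [norm_trialCoeff_sq, hH]
  have hz : ∀ᶠ n in atTop, ‖z n‖ ^ 2 = H := by
    have : ∀ᶠ n in atTop, ∀ k ∈ Finset.range N, ∀ l ∈ Finset.range N,
        inner ℂ (e n (k : ℤ)) (e n (l : ℤ)) = if k = l then (1 : ℂ) else 0 := by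
      simp only [Filter.eventually_all_finset]
      intro k _ l _
      filter_upwards [horth k l] with n hn
      rw [hn]
      simp
    filter_upwards [this] with n hn
    rw [norm_sum_smul_sq (f := fun k : ℕ => e n (k : ℤ)) fun k hk l hl =>
      hn k (Finset.mem_range.mpr hk) l (Finset.mem_range.mpr hl)]
    simp only [norm_trialCoeff_sq, hH]
  have hQy : ∀ᶠ n : ℕ in atTop, spectralProjection (Jz (n + 1))
      (Set.Ioc 0 (b * (((n : ℝ) + 1) / 2))) (y n) = y n := by
    have := (Filter.eventually_all_finset (Finset.range N)).mpr fun l _ =>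
      hQ1 (-((l : ℤ) + 1)) (by omega)
    filter_upwards [this] with n hn
    simp only [y, map_sum, map_smul]
    exact Finset.sum_congr rfl fun l hl => by rw [hn l hl]
  have hQz : ∀ᶠ n : ℕ in atTop, spectralProjection (Jz (n + 1))
      (Set.Ioc 0 (b * (((n : ℝ) + 1) / 2))) (z n) = 0 := by
    have := (Filter.eventually_all_finset (Finset.range N)).mpr fun (k : ℕ) _ =>
      hQ0 (k : ℤ) (by omega)
    filter_upwards [this] with n hn
    simp only [z, map_sum, map_smul]
    exact Finset.sum_eq_zero fun l hl => by rw [hn l hl, smul_zero]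
  have hlim : Tendsto (fun n : ℕ => inner ℂ (z n) (spectralProjection (Jx (n + 1))
      (Set.Ioi (a * (((n : ℝ) + 1) / 2))) (y n))) atTop
      (𝓝 (∑ k ∈ Finset.range N, ∑ l ∈ Finset.range N, conj (trialCoeff (-(α * (k + 1))) k) *
        (trialCoeff (α * l) l *
          ((cosFourierCoeff ((Set.Ioi a).indicator 1) ((k : ℤ) - -((l : ℤ) + 1)) : ℝ) : ℂ)))) := by
    have := tendsto_finsetSum (Finset.range N) fun k _ =>
      tendsto_finsetSum (Finset.range N) fun l _ =>
        ((hP (k : ℤ) (-((l : ℤ) + 1))).const_mul (trialCoeff (α * l) l)).const_mul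
          (conj (trialCoeff (-(α * (k + 1))) k))
    refine this.congr fun n => ?_
    simp only [y, z, map_sum, map_smul, sum_inner, inner_sum, inner_smul_left, inner_smul_right,
      Finset.mul_sum]
    rw [Finset.sum_comm]
    refine Finset.sum_congr rfl fun k _ => Finset.sum_congr rfl fun l _ => ?_
    ring
  set W := ∑ k ∈ Finset.range N, ∑ l ∈ Finset.range N, conj (trialCoeff (-(α * (k + 1))) k) *
        (trialCoeff (α * l) l *
          ((cosFourierCoeff ((Set.Ioi a).indicator 1) ((k : ℤ) - -((l : ℤ) + 1)) : ℝ) : ℂ)) with hW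
  have hWim : W.im = ∑ k ∈ Finset.range N, ∑ l ∈ Finset.range N,
      1 / √((k : ℝ) + 1) * (1 / √((l : ℝ) + 1)) *
        (sin (((k : ℝ) + l + 1) * α) ^ 2 / (π * ((k : ℝ) + l + 1))) := by
    rw [hW, Complex.im_sum]
    refine Finset.sum_congr rfl fun k _ => ?_
    rw [Complex.im_sum]
    refine Finset.sum_congr rfl fun l _ => ?_
    rw [im_conj_trialCoeff_mul_mul, cosFourierCoeff_indicator_Ioi ⟨by linarith [ha.1], ha.2.le⟩
      (by omega)]
    have e1 : α * (l : ℝ) - -(α * ((k : ℝ) + 1)) = ((k : ℝ) + l + 1) * α := by ring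
    have e2 : (((k : ℤ) - -((l : ℤ) + 1) : ℤ) : ℝ) = (k : ℝ) + l + 1 := by push_cast; ring
    rw [e1, e2, ← hα]
    ring
  have hWnorm : x * H < ‖W‖ := by
    refine lt_of_lt_of_le ?_ ((le_abs_self _).trans (Complex.abs_im_le_norm W))
    rw [hWim]
    refine lt_of_lt_of_le ?_ hCN
    linarith
  filter_upwards [hy, hz, hQy, hQz, hlim.norm.eventually_const_lt hWnorm] with n h1 h2 h3 h4 h5
  rw [spinCommutator_eq (hV' n)]
  have h6 := norm_inner_le_norm_commutator_mul
    (spectralProjection (Jx (n + 1)) (Set.Ioi (a * (((n : ℝ) + 1) / 2)))) _ h3 h4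
  have h7 : ‖z n‖ * ‖y n‖ = H := by
    have : ‖z n‖ = ‖y n‖ := (sq_eq_sq₀ (norm_nonneg _) (norm_nonneg _)).mp (h2.trans h1.symm)
    rw [this, ← sq, h1]
  rw [h7] at h6
  exact lt_of_mul_lt_mul_right (h5.trans_le h6) hN0.le
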